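/- **Setting.** Consider a game with finitely many players $i=1,\dots,N$. Player $i$ chooses a matrix in $\mathcal X_i=\{X_i\in\mathbb C^{M_i\times M_i}\ \text{Hermitian}: X_i\succcurlyeq 0,\ \|X_i\|\le A_i\}$, where $A_i>0$ and $\|\cdot\|$ is the nuclear norm $\sum_m|\mathrm{eig}_m(\cdot)|$; put $\mathcal X=\prod_i\mathcal X_i$ and identify a profile $X=(X_1,\dots,X_N)$ with $\mathrm{diag}(X_1,\dots,X_N)$. Each payoff $u_i$ is concave and differentiable in $X_i$, with Hermitian gradients $V_i(X)=\nabla_{X_i}u_i(X_i;X_{-i})$ (with respect to the trace inner product) such that $V=(V_1,\dots,V_N)$ is continuous on $\mathcal X$. A profile $X^*\in\mathcal X$ is called *(locally) stable* if $\mathrm{tr}[(X-X^*)V(X)]\le 0$ for all $X\in\mathcal X$ sufficiently close to $X^*$, with equality only for $X=X^*$. *Matrix exponential learning* with step sizes $\gamma_n>0$ and an arbitrary (possibly random) Hermitian initial score $Y(0)$ is the process $$X_i(n)=A_i\,\frac{\exp(Y_i(n))}{1+\|\exp(Y_i(n))\|},\qquad Y_i(n+1)=Y_i(n)+\gamma_n\big(V_i(X(n))+Z_i(n)\big),\qquad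 n=0,1,\dots,$$ where the $Z(n)$ are random Hermitian errors. Let $\mathcal F_n$ be the $\sigma$-algebra generated by $X(0),\dots,X(n)$, and let $\|Z\|_*=\max_j|\mathrm{eig}_j(Z)|$. The hypotheses on the errors are: * (H1) $\mathbb E[Z(n)\mid\mathcal F_n]=0$ for all $n$; * (H2$'$) for some $\sigma_*>0$: $\mathbb E[\|Z(n)\|_*^p\mid\mathcal F_n]\le \frac{p!}{2}\sigma_*^p$ for all $n$ and all integers $p\ge1$. For $P\in\mathcal X$ and $X\in\mathcal X$ with $X_i\succ0$, $\mathrm{tr}X_i<A_i$ for all $i$ (as holds for all iterates $X(n)$), let $$D(P,X)=\sum_i\Big(\mathrm{tr}[P_i(\log P_i-\log X_i)]+(A_i-\mathrm{tr}P_i)\log\frac{A_i-\mathrm{tr}P_i}{A_i-\mathrm{tr}X_i}\Big)\qquad(0\log0=0)$$ be the quantum Kullback–Leibler divergence (including the slacks $A_i-\mathrm{tr}X_i$). **Theorem.** Let $X^*$ be stable. For every $\varepsilon>0$ there is a (Borel) set $U_\varepsilon\subseteq\mathcal X$ which is a neighbourhood of $X^*$ with respect to the divergence, i.e. $X^*\in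 U_\varepsilon$ and, for some $m>0$, $U_\varepsilon$ contains every $X$ with $X_i\succ 0$, $\mathrm{tr}X_i<A_i$ for all $i$ and $D(X^*,X)<m$, and which is also a neighbourhood of $X^*$ in $\mathcal X$ in the usual topology if each block $X_i^*$ is either $0$ or positive definite, such that the following holds. For every $\sigma_*>0$ there is $\delta>0$ such that, if matrix exponential learning is run with errors satisfying (H1) and (H2$'$) with constant $\sigma_*$, and with step sizes satisfying $\sum_{n}\gamma_n^{1+q}<\sum_{n}\gamma_n=\infty$ for some $q\in(0,1)$ and small enough that $\sum_{n\ge0}\gamma_n^2\le\delta$, then, provided that $\mathbb P(X(0)\in U_\varepsilon)>0$, $$\mathbb P\big(X(n)\to X^*\ \big|\ X(0)\in U_\varepsilon\big)\ \ge\ 1-\varepsilon .$$ -/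

import Mathlib

open Filter Topology MeasureTheory ProbabilityTheory Asymptotics
open scoped Matrix.Norms.L2Operator ComplexOrder Nat

noncomputable section

/-- Profiles `X = (X_1, …, X_N)` of complex square matrices, `X_i` of size `d i`. With the `L²`
operator norm on each block, the (supremum) norm of a profile of Hermitian matrices is the largest
absolute value of an eigenvalue of the block-diagonal matrix `diag(X_1, …, X_N)`, i.e. its singular
(spectral) norm. -/
abbrev Profile {ι : Type*} (d : ι → ℕ) : Type _ :=
  (i : ι) → Matrix (Fin (d i)) (Fin (d i)) ℂ

/-- The nuclear norm `∑ |eig_j(M)|` of a Hermitian matrix, the eigenvalues being counted with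
multiplicity. -/
def nuclearNorm {m : ℕ} (M : Matrix (Fin m) (Fin m) ℂ) : ℝ :=
  (M.charpoly.roots.map fun z : ℂ => ‖z‖).sum

/-- The action set `{X ≽ 0 : ‖X‖ ≤ a}` of a single player (nuclear norm). -/
def actionSet (m : ℕ) (a : ℝ) : Set (Matrix (Fin m) (Fin m) ℂ) :=
  {X | X.PosSemidef ∧ nuclearNorm X ≤ a}

/-- The set of feasible action profiles. -/
def feasible {ι : Type*} {d : ι → ℕ} (A : ι → ℝ) : Set (Profile d) :=
  {X | ∀ i, X i ∈ actionSet (d i) (A i)}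

/-- `tr(X V)` for profiles identified with block-diagonal matrices
(a real number when all blocks are Hermitian). -/
def tracePairing {ι : Type*} [Fintype ι] {d : ι → ℕ} (X V : Profile d) : ℝ :=
  ∑ i, (Matrix.trace (X i * V i)).re

section Game

variable {ι : Type*} [Fintype ι] [DecidableEq ι] {d : ι → ℕ}

/-- The Hermitian matrix `G` is the gradient at `X_i`, with respect to the trace inner product and
along the action set of player `i`, of the payoff `Z ↦ u_i(Z; X_{-i})`. -/
def HasPayoffGradientAt (A : ι → ℝ) (u : ι → Profile d → ℝ) (X : Profile d) (i : ι)
    (G : Matrix (Fin (d i)) (Fin (d i)) ℂ) : Prop :=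
  G.IsHermitian ∧
    (fun Z : Matrix (Fin (d i)) (Fin (d i)) ℂ =>
        u i (Function.update X i Z) - u i X - (Matrix.trace ((Z - X i) * G)).re)
      =o[𝓝[actionSet (d i) (A i)] (X i)] fun Z => Z - X i

open Classical in
/-- The profile `V(X)` of individual payoff gradients `V_i(X) = ∇_{X_i} u_i(X_i; X_{-i})`. -/
def payoffGradient (A : ι → ℝ) (u : ι → Profile d → ℝ) (X : Profile d) : Profile d := fun i =>
  if h : ∃ G, HasPayoffGradientAt A u X i G then h.choose else 0

/-- Individually concave and (continuously) differentiable payoff functions. -/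
structure IsConcaveGame (A : ι → ℝ) (u : ι → Profile d → ℝ) : Prop where
  radius_pos : ∀ i, 0 < A i
  concave : ∀ i, ∀ X ∈ feasible A,
    ConcaveOn ℝ (actionSet (d i) (A i)) fun Z => u i (Function.update X i Z)
  differentiable : ∀ i, ∀ X ∈ feasible A, ∃ G, HasPayoffGradientAt A u X i G
  continuous_gradient : ContinuousOn (payoffGradient A u) (feasible A)

/-- (Local) variational stability: `tr((X - X*) V(X)) ≤ 0` for all feasible `X` sufficiently close
to `X*`, with equality only at `X = X*`. -/
def IsVariationallyStable (A : ι → ℝ) (u : ι → Profile d → ℝ) (Xs : Profile d) : Prop :=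
  Xs ∈ feasible A ∧
    ∀ᶠ X in 𝓝[feasible A] Xs, X ≠ Xs → tracePairing (X - Xs) (payoffGradient A u X) < 0

/-- The exponential step `X_i = A_i exp(Y_i) / (1 + ‖exp(Y_i)‖)`. -/
def mirrorMap (A : ι → ℝ) (Y : Profile d) : Profile d := fun i =>
  (A i / (1 + nuclearNorm (NormedSpace.exp (Y i)))) • NormedSpace.exp (Y i)

/-- The quantum Kullback–Leibler divergence `D(P, X)` of the blocks augmented by their slacks
`A_i - tr(P_i)`, `A_i - tr(X_i)`. -/
def klDivergence (A : ι → ℝ) (P X : Profile d) : ℝ :=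
  ∑ i, ((Matrix.trace (P i * (CFC.log (P i) - CFC.log (X i)))).re +
    (A i - (Matrix.trace (P i)).re) *
      (Real.log (A i - (Matrix.trace (P i)).re) - Real.log (A i - (Matrix.trace (X i)).re)))

/-- `U` is a neighbourhood of `Xs` as measured by the divergence: it contains `Xs` and all
`X` with `X_i ≻ 0`, `tr X_i < A_i` and `D(Xs, X) < m`, for some `m > 0`. -/
def IsDivergenceNhd (A : ι → ℝ) (Xs : Profile d) (U : Set (Profile d)) : Prop :=
  Xs ∈ U ∧ ∃ m > 0, ∀ X : Profile d,
    (∀ i, (X i).PosDef ∧ (Matrix.trace (X i)).re < A i) → klDivergence A Xs X < m → X ∈ U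

end Game

section Dynamics

variable {ι : Type*} [Fintype ι] [DecidableEq ι] {d : ι → ℕ} {Ω : Type*}

/-- The `σ`-algebra generated by the history of play `X(0), …, X(n)`. -/
abbrev playHistory (X : ℕ → Ω → Profile d) (n : ℕ) : MeasurableSpace Ω :=
  ⨆ k : ℕ, ⨆ _ : k ≤ n, MeasurableSpace.comap (X k) (borel (Profile d))

/-- The sequence of play `X(n)` induced by the scores `Y(n)`. -/
def play (A : ι → ℝ) (Y : ℕ → Ω → Profile d) (n : ℕ) (ω : Ω) : Profile d :=
  mirrorMap A (Y n ω)

/-- Matrix exponential learning with Hermitian scores `Y(n)`, arbitrary (possibly random) initial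
score `Y(0)`, step sizes `γ n` and gradient feedback `V(X(n)) + Z(n)`. -/
structure IsMXL [MeasurableSpace Ω] (A : ι → ℝ) (u : ι → Profile d → ℝ) (γ : ℕ → ℝ)
    (Y Z : ℕ → Ω → Profile d) : Prop where
  measurable_score : ∀ n, StronglyMeasurable (Y n)
  hermitian_init : ∀ ω i, (Y 0 ω i).IsHermitian
  hermitian_noise : ∀ n ω i, (Z n ω i).IsHermitian
  step : ∀ n ω, Y (n + 1) ω = Y n ω + γ n • (payoffGradient A u (play A Y n ω) + Z n ω)

/-- Zero-mean errors, given the history of play. -/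
def ZeroMeanNoise [MeasurableSpace Ω] (μ : Measure Ω) (X Z : ℕ → Ω → Profile d) : Prop :=
  ∀ n, Integrable (Z n) μ ∧ μ[Z n | playHistory X n] =ᵐ[μ] 0

/-- Subexponential moment growth of the errors, given the history of play. -/
def SubexpNoise [MeasurableSpace Ω] (μ : Measure Ω) (σ : ℝ) (X Z : ℕ → Ω → Profile d) : Prop :=
  ∀ n p : ℕ, 1 ≤ p → Integrable (fun ω => ‖Z n ω‖ ^ p) μ ∧
    ∀ᵐ ω ∂μ, (μ[fun ω' => ‖Z n ω'‖ ^ p | playHistory X n]) ω ≤ (p ! : ℝ) / 2 * σ ^ p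

end Dynamics

end

/-! The divergence from `X*` is a local Lyapunov function. On an exponential step, `log X_i` is the
score `Y_i` shifted by the scalar log-slack, so the divergence is the Fenchel coupling of an entropy
with a log-partition function (`klDivergence_mirrorMap`) and obeys a three-point identity. A
quadratic Klein inequality bounds squared distances by the divergence
(`sq_norm_sub_le_klDivergence`). Together they make the exponential step Lipschitz and give
`klDivergence_play_succ_le`: per round, `D` grows by at most a drift `γ ⟨X - X*, V(X)⟩`, a
martingale difference `γ ⟨X - X*, Z⟩`, and an error of order `γ² (1 + ‖Z‖²)`.

Choose `m` so that `D < 3m` forces `X` into the ball where stability makes the drift nonpositive. If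
`D < m` initially, the noise sums stay below `m` and the errors sum to at most `m`, then `D < 3m`
forever and the accumulated drift is finite (`descent_trap`). By Doob's and Markov's inequalities
the two noise conditions fail with probability at most a constant times `∑ γ²`.

Convergence is not read off `D`, which need not vanish as `X → X*` when some `X*_i` is singular and
nonzero. Instead (`tendsto_of_summable_step_mul`), finite drift means that only a finite total step
size is spent away from `X*`, while the Lipschitz bound and the almost sure convergence of `∑ γ Z`
make every excursion cost a fixed amount of step size. Late excursions are therefore impossible. -/

/-! ### Nuclear norm and exponential of Hermitian matrices -/

theorem nuclearNorm_posSemidef {m : ℕ} {M : Matrix (Fin m) (Fin m) ℂ} (hM : M.PosSemidef) :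
    nuclearNorm M = M.trace.re := by
  have h := hM.isHermitian
  rw [nuclearNorm, h.roots_charpoly_eq_eigenvalues, h.trace_eq_sum_eigenvalues]
  simp only [Multiset.map_map, Function.comp_def, Complex.re_sum]
  refine Finset.sum_congr rfl fun i _ => ?_
  simp [abs_of_nonneg (hM.eigenvalues_nonneg i)]

/-- `exp Y = Eᴴ E` with `E = exp (Y / 2)` Hermitian and invertible. -/
theorem posDef_exp {m : ℕ} {Y : Matrix (Fin m) (Fin m) ℂ} (hY : Y.IsHermitian) :
    (NormedSpace.exp Y).PosDef := by
  have h1 : (NormedSpace.exp ((1 / 2 : ℂ) • Y)).IsHermitian := by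
    apply Matrix.IsHermitian.exp
    rw [Matrix.IsHermitian, Matrix.conjTranspose_smul, hY.eq]
    simp
  have h2 : NormedSpace.exp Y =
      (NormedSpace.exp ((1 / 2 : ℂ) • Y)).conjTranspose * NormedSpace.exp ((1 / 2 : ℂ) • Y) := by
    rw [h1.eq, ← Matrix.exp_add_of_commute _ _ (Commute.refl _), ← add_smul]
    norm_num
  rw [h2]
  refine Matrix.PosDef.conjTranspose_mul_self _ ?_
  exact Matrix.mulVec_injective_of_isUnit (Matrix.isUnit_exp _)

/-! ### Klein's inequality with a quadratic lower bound -/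

/-- The overlap weights `|⟨a_j, b_k⟩|²` of two orthonormal eigenbases. -/
noncomputable def spectralOverlap {m : ℕ} {P X : Matrix (Fin m) (Fin m) ℂ} (hP : P.IsHermitian)
    (hX : X.IsHermitian) (j k : Fin m) : ℝ :=
  Complex.normSq ((star (hP.eigenvectorUnitary : Matrix (Fin m) (Fin m) ℂ) *
    (hX.eigenvectorUnitary : Matrix (Fin m) (Fin m) ℂ)) j k)

/-- Expanding in both eigenbases gives nonnegative weights that do not depend on `f` and `g`, so
scalar inequalities between eigenvalues pass to traces even when `P` and `X` do not commute. -/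
theorem re_trace_cfc_mul_cfc {m : ℕ} {P X : Matrix (Fin m) (Fin m) ℂ} (hP : P.IsHermitian)
    (hX : X.IsHermitian) (f g : ℝ → ℝ) :
    (Matrix.trace (cfc f P * cfc g X)).re =
      ∑ j, ∑ k, f (hP.eigenvalues j) * g (hX.eigenvalues k) * spectralOverlap hP hX j k := by
  rw [hP.cfc_eq, hX.cfc_eq, Matrix.IsHermitian.cfc, Matrix.IsHermitian.cfc,
    Unitary.conjStarAlgAut_apply, Unitary.conjStarAlgAut_apply]
  set U := (hP.eigenvectorUnitary : Matrix (Fin m) (Fin m) ℂ) with hU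
  set W := (hX.eigenvectorUnitary : Matrix (Fin m) (Fin m) ℂ) with hW
  set F : Matrix (Fin m) (Fin m) ℂ := Matrix.diagonal (RCLike.ofReal ∘ f ∘ hP.eigenvalues)
  set G : Matrix (Fin m) (Fin m) ℂ := Matrix.diagonal (RCLike.ofReal ∘ g ∘ hX.eigenvalues)
  have h1 : Matrix.trace (U * F * star U * (W * G * star W)) =
      Matrix.trace (F * (star U * W) * (G * star (star U * W))) := by
    rw [star_mul, star_star, mul_assoc U, mul_assoc U, Matrix.trace_mul_comm]
    simp only [mul_assoc]
  rw [h1, Matrix.trace, Complex.re_sum]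
  refine Finset.sum_congr rfl fun j _ => ?_
  rw [Matrix.diag_apply, Matrix.mul_apply, Complex.re_sum]
  refine Finset.sum_congr rfl fun k _ => ?_
  rw [Matrix.diagonal_mul, Matrix.diagonal_mul, Matrix.star_apply, spectralOverlap, ← hU, ← hW]
  have : ∀ (a b : ℝ) (z : ℂ), ((a : ℂ) * z * ((b : ℂ) * star z)).re = a * b * Complex.normSq z := by
    intro a b z
    simp [Complex.normSq_apply]
    ring
  exact this _ _ _

theorem spectralOverlap_nonneg {m : ℕ} {P X : Matrix (Fin m) (Fin m) ℂ} (hP : P.IsHermitian)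
    (hX : X.IsHermitian) (j k : Fin m) : 0 ≤ spectralOverlap hP hX j k :=
  Complex.normSq_nonneg _

/-- The Bregman divergence of `x log x - x` dominates the squared distance on `[0, a]`. -/
theorem sq_div_le_mul_log_sub {a p x : ℝ} (hp : 0 ≤ p) (hx : 0 < x) (hpa : p ≤ a) (hxa : x ≤ a) :
    (p - x) ^ 2 / (4 * a) ≤ p * (Real.log p - Real.log x) - p + x := by
  have ha : 0 < a := hx.trans_le hxa
  rw [div_le_iff₀ (by positivity)]
  obtain ⟨s, hs, rfl⟩ : ∃ s, 0 ≤ s ∧ s ^ 2 = p := ⟨√p, Real.sqrt_nonneg _, Real.sq_sqrt hp⟩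
  obtain ⟨t, ht, rfl⟩ : ∃ t, 0 < t ∧ t ^ 2 = x := ⟨√x, Real.sqrt_pos.2 hx, Real.sq_sqrt hx.le⟩
  -- A Hellinger-type bound, from `log (t / s) ≤ t / s - 1`; passing to square roots supplies the
  -- quadratic term.
  have h1 : (s - t) ^ 2 ≤ s ^ 2 * (Real.log (s ^ 2) - Real.log (t ^ 2)) - s ^ 2 + t ^ 2 := by
    rcases hs.eq_or_lt with rfl | hs
    · simp
    · have h2 : Real.log (t / s) ≤ t / s - 1 := Real.log_le_sub_one_of_pos (by positivity)
      rw [Real.log_div ht.ne' hs.ne'] at h2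
      have h3 : s ^ 2 * (Real.log t - Real.log s) ≤ s ^ 2 * (t / s - 1) := by gcongr
      have h4 : s ^ 2 * (t / s - 1) = s * t - s ^ 2 := by field_simp
      rw [Real.log_pow, Real.log_pow]
      push_cast
      nlinarith
  have h5 : (s ^ 2 - t ^ 2) ^ 2 = (s - t) ^ 2 * (s + t) ^ 2 := by ring
  have h6 : (s + t) ^ 2 ≤ 4 * a := by nlinarith [sq_nonneg (s - t)]
  rw [h5]
  calc (s - t) ^ 2 * (s + t) ^ 2 ≤ (s - t) ^ 2 * (4 * a) := by gcongr
    _ ≤ _ := by gcongr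

/-- A quadratic form of Klein's inequality. -/
theorem sq_div_le_re_trace_mul_log_sub {m : ℕ} {P X : Matrix (Fin m) (Fin m) ℂ} {a : ℝ}
    (hP : P.PosSemidef) (hX : X.PosDef) (hPa : P.trace.re ≤ a) (hXa : X.trace.re ≤ a) :
    (Matrix.trace ((P - X) * (P - X))).re / (4 * a) ≤
      (Matrix.trace (P * (CFC.log P - CFC.log X))).re - P.trace.re + X.trace.re := by
  have hPh := hP.isHermitian
  have hXh := hX.isHermitian
  have hP1 : IsSelfAdjoint P := hPh
  have hX1 : IsSelfAdjoint X := hXh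
  -- The spectrum is finite, so any function is continuous on it, including `Real.log` when `P` is
  -- singular.
  have cP : ∀ f : ℝ → ℝ, ContinuousOn f (spectrum ℝ P) := fun f =>
    (Matrix.finite_real_spectrum (A := P)).continuousOn f
  have cX : ∀ f : ℝ → ℝ, ContinuousOn f (spectrum ℝ X) := fun f =>
    (Matrix.finite_real_spectrum (A := X)).continuousOn f
  -- The identity is inserted as a constant `cfc`, so that all the traces expand over the same
  -- overlap weights.
  have e1 : P * CFC.log P = cfc (fun x : ℝ => x * Real.log x) P * cfc (fun _ => (1 : ℝ)) X := by
    rw [cfc_mul _ _ P (cP _) (cP _), cfc_id' ℝ P, cfc_const_one ℝ X, mul_one, CFC.log]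
  have e2 : P * CFC.log X = cfc (fun x : ℝ => x) P * cfc Real.log X := by
    rw [cfc_id' ℝ P, CFC.log]
  have e3 : P = cfc (fun x : ℝ => x) P * cfc (fun _ => (1 : ℝ)) X := by
    rw [cfc_id' ℝ P, cfc_const_one ℝ X, mul_one]
  have e4 : X = cfc (fun _ => (1 : ℝ)) P * cfc (fun x : ℝ => x) X := by
    rw [cfc_id' ℝ X, cfc_const_one ℝ P, one_mul]
  have e5 : P * P = cfc (fun x : ℝ => x * x) P * cfc (fun _ => (1 : ℝ)) X := by
    rw [cfc_mul _ _ P (cP _) (cP _), cfc_id' ℝ P, cfc_const_one ℝ X, mul_one]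
  have e6 : X * X = cfc (fun _ => (1 : ℝ)) P * cfc (fun x : ℝ => x * x) X := by
    rw [cfc_mul _ _ X (cX _) (cX _), cfc_id' ℝ X, cfc_const_one ℝ P, one_mul]
  have e7 : P * X = cfc (fun x : ℝ => x) P * cfc (fun x : ℝ => x) X := by
    rw [cfc_id' ℝ P, cfc_id' ℝ X]
  have k1 : (Matrix.trace ((P - X) * (P - X))).re = ∑ j, ∑ k,
      (hPh.eigenvalues j - hXh.eigenvalues k) ^ 2 * spectralOverlap hPh hXh j k := by
    have : Matrix.trace ((P - X) * (P - X)) =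
        Matrix.trace (P * P) - 2 * Matrix.trace (P * X) + Matrix.trace (X * X) := by
      rw [sub_mul, mul_sub, mul_sub, Matrix.trace_sub, Matrix.trace_sub, Matrix.trace_sub,
        Matrix.trace_mul_comm X P]
      ring
    rw [this, e5, e6, e7]
    simp only [Complex.add_re, Complex.sub_re, Complex.mul_re, Complex.re_ofNat, Complex.im_ofNat,
      zero_mul, sub_zero, re_trace_cfc_mul_cfc hPh hXh, Finset.mul_sum,
      ← Finset.sum_sub_distrib, ← Finset.sum_add_distrib]
    exact Finset.sum_congr rfl fun j _ => Finset.sum_congr rfl fun k _ => by ring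
  have k2 : (Matrix.trace (P * (CFC.log P - CFC.log X))).re - P.trace.re + X.trace.re =
      ∑ j, ∑ k, (hPh.eigenvalues j * (Real.log (hPh.eigenvalues j) - Real.log (hXh.eigenvalues k))
        - hPh.eigenvalues j + hXh.eigenvalues k) * spectralOverlap hPh hXh j k := by
    rw [mul_sub, Matrix.trace_sub, e1, e2, congrArg Matrix.trace e3, congrArg Matrix.trace e4]
    simp only [Complex.sub_re, re_trace_cfc_mul_cfc hPh hXh,
      ← Finset.sum_sub_distrib, ← Finset.sum_add_distrib]
    exact Finset.sum_congr rfl fun j _ => Finset.sum_congr rfl fun k _ => by ring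
  rw [k1, k2, Finset.sum_div]
  refine Finset.sum_le_sum fun j _ => ?_
  rw [Finset.sum_div]
  refine Finset.sum_le_sum fun k _ => ?_
  rw [mul_div_right_comm]
  have le_tr : ∀ {M : Matrix (Fin m) (Fin m) ℂ} (hM : M.PosSemidef) (i : Fin m),
      hM.isHermitian.eigenvalues i ≤ M.trace.re := by
    intro M hM i
    rw [hM.isHermitian.trace_eq_sum_eigenvalues, Complex.re_sum]
    exact Finset.single_le_sum (f := fun i => ((hM.isHermitian.eigenvalues i : ℂ)).re)
      (fun i _ => by simpa using hM.eigenvalues_nonneg i) (Finset.mem_univ i)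
  exact mul_le_mul_of_nonneg_right (sq_div_le_mul_log_sub (hP.eigenvalues_nonneg j)
    (hX.eigenvalues_pos k) ((le_tr hP j).trans hPa) ((le_tr hX.posSemidef k).trans hXa))
    (spectralOverlap_nonneg _ _ _ _)

/-! ### Operator norm bounds and compactness of the action set -/

/-- For Hermitian `M` the right side is the squared Frobenius norm, which dominates the operator
norm by Cauchy–Schwarz in each row. -/
theorem sq_norm_le_re_trace_mul_self {m : ℕ} {M : Matrix (Fin m) (Fin m) ℂ} (hM : M.IsHermitian) :
    ‖M‖ ^ 2 ≤ (Matrix.trace (M * M)).re := by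
  have key : (Matrix.trace (M * M)).re = ∑ i, ∑ j, ‖M i j‖ ^ 2 := by
    nth_rewrite 1 [← hM.eq]
    rw [Matrix.trace_mul_comm]
    simp only [Matrix.trace, Matrix.diag_apply, Matrix.mul_apply, Complex.re_sum,
      Matrix.conjTranspose_apply]
    refine Finset.sum_congr rfl fun i _ => Finset.sum_congr rfl fun j _ => ?_
    rw [← Complex.normSq_eq_norm_sq, Complex.normSq_apply]
    simp
  rw [key]
  have h0 : 0 ≤ ∑ i, ∑ j, ‖M i j‖ ^ 2 := by positivity
  suffices h : ‖M‖ ≤ √(∑ i, ∑ j, ‖M i j‖ ^ 2) from (Real.le_sqrt (norm_nonneg _) h0).1 h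
  rw [Matrix.l2_opNorm_def]
  refine ContinuousLinearMap.opNorm_le_bound _ (Real.sqrt_nonneg _) fun x => ?_
  refine (pow_le_pow_iff_left₀ (norm_nonneg _) (by positivity) two_ne_zero).1 ?_
  rw [mul_pow, Real.sq_sqrt h0, EuclideanSpace.norm_sq_eq, EuclideanSpace.norm_sq_eq,
    Finset.sum_mul]
  refine Finset.sum_le_sum fun i _ => ?_
  have h1 : ‖∑ j, M i j * x j‖ ≤ ∑ j, ‖M i j‖ * ‖x j‖ :=
    (norm_sum_le _ _).trans_eq (Finset.sum_congr rfl fun j _ => norm_mul _ _)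
  have h2 := Finset.sum_mul_sq_le_sq_mul_sq Finset.univ (fun j => ‖M i j‖) fun j => ‖x j‖
  refine le_trans ?_ h2
  refine pow_le_pow_left₀ (norm_nonneg _) ?_ 2
  refine le_trans (le_of_eq ?_) h1
  rfl

theorem mem_actionSet_iff {m : ℕ} {a : ℝ} {X : Matrix (Fin m) (Fin m) ℂ} :
    X ∈ actionSet m a ↔ X.PosSemidef ∧ X.trace.re ≤ a :=
  and_congr_right fun h => by rw [nuclearNorm_posSemidef h]

/-- The eigenvalues lie in `[0, a]`, so `tr X² ≤ a tr X ≤ a²`. -/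
theorem norm_le_of_mem_actionSet {m : ℕ} {a : ℝ} {X : Matrix (Fin m) (Fin m) ℂ}
    (h : X ∈ actionSet m a) : ‖X‖ ≤ a := by
  obtain ⟨hX, ht⟩ := mem_actionSet_iff.1 h
  have hXh := hX.isHermitian
  have hX1 : IsSelfAdjoint X := hXh
  have cX : ∀ f : ℝ → ℝ, ContinuousOn f (spectrum ℝ X) := fun f =>
    (Matrix.finite_real_spectrum (A := X)).continuousOn f
  have h0 : ∀ i, 0 ≤ hXh.eigenvalues i := hX.eigenvalues_nonneg
  have h1 : ∀ i, hXh.eigenvalues i ≤ a := by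
    intro i
    refine le_trans ?_ ht
    rw [hXh.trace_eq_sum_eigenvalues, Complex.re_sum]
    exact Finset.single_le_sum (f := fun i => ((hXh.eigenvalues i : ℂ)).re)
      (fun i _ => by simpa using h0 i) (Finset.mem_univ i)
  have ha : 0 ≤ a := le_trans (by
    rw [hXh.trace_eq_sum_eigenvalues, Complex.re_sum]
    exact Finset.sum_nonneg fun i _ => by simpa using h0 i) ht
  refine (pow_le_pow_iff_left₀ (norm_nonneg _) ha two_ne_zero).1 ?_
  refine (sq_norm_le_re_trace_mul_self hXh).trans ?_
  have e5 : X * X = cfc (fun x : ℝ => x * x) X * cfc (fun _ => (1 : ℝ)) X := by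
    rw [cfc_mul _ _ X (cX _) (cX _), cfc_id' ℝ X, cfc_const_one ℝ X, mul_one]
  have e3 : X = cfc (fun x : ℝ => x) X * cfc (fun _ => (1 : ℝ)) X := by
    rw [cfc_id' ℝ X, cfc_const_one ℝ X, mul_one]
  calc (Matrix.trace (X * X)).re ≤ a * (Matrix.trace X).re := by
        rw [e5, congrArg Matrix.trace e3, re_trace_cfc_mul_cfc hXh hXh,
          re_trace_cfc_mul_cfc hXh hXh, Finset.mul_sum]
        refine Finset.sum_le_sum fun j _ => ?_
        rw [Finset.mul_sum]
        refine Finset.sum_le_sum fun k _ => ?_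
        have h2 := mul_le_mul_of_nonneg_right (h1 j)
          (mul_nonneg (h0 j) (spectralOverlap_nonneg hXh hXh j k))
        linarith
    _ ≤ a ^ 2 := by rw [sq]; gcongr

theorem isClosed_actionSet (m : ℕ) (a : ℝ) : IsClosed (actionSet m a) := by
  have h : actionSet m a = {X | X.PosSemidef} ∩ {X | X.trace.re ≤ a} := by
    ext X
    exact mem_actionSet_iff
  rw [h]
  refine IsClosed.inter ?_ (isClosed_le (by fun_prop) continuous_const)
  simp only [Matrix.posSemidef_iff_dotProduct_mulVec, Set.ofPred_and, Set.ofPred_forall]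
  refine IsClosed.inter (isClosed_eq (by fun_prop) continuous_id) (isClosed_iInter fun x => ?_)
  exact isClosed_le continuous_const (by fun_prop)

theorem isCompact_actionSet (m : ℕ) (a : ℝ) : IsCompact (actionSet m a) :=
  Metric.isCompact_of_isClosed_isBounded (isClosed_actionSet m a)
    ((Metric.isBounded_closedBall (x := 0) (r := a)).subset fun _ hX =>
      mem_closedBall_zero_iff.2 (norm_le_of_mem_actionSet hX))

/-! ### Exponential step and divergence of one block -/

/-- The exponential step of a single player. -/
noncomputable def expStep {m : ℕ} (a : ℝ) (Y : Matrix (Fin m) (Fin m) ℂ) :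
    Matrix (Fin m) (Fin m) ℂ :=
  (a / (1 + nuclearNorm (NormedSpace.exp Y))) • NormedSpace.exp Y

section ExpStep

variable {m : ℕ} {a : ℝ} {Y : Matrix (Fin m) (Fin m) ℂ}

theorem re_trace_exp_nonneg (hY : Y.IsHermitian) : 0 ≤ (NormedSpace.exp Y).trace.re :=
  (Complex.nonneg_iff.1 (posDef_exp hY).posSemidef.trace_nonneg).1

theorem expStep_eq (hY : Y.IsHermitian) :
    expStep a Y = (a / (1 + (NormedSpace.exp Y).trace.re)) • NormedSpace.exp Y := by
  rw [expStep, nuclearNorm_posSemidef (posDef_exp hY).posSemidef]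

theorem posDef_expStep (ha : 0 < a) (hY : Y.IsHermitian) : (expStep a Y).PosDef := by
  have := re_trace_exp_nonneg hY
  rw [expStep_eq hY, ← Complex.coe_smul]
  refine (posDef_exp hY).smul ?_
  have : 0 < a / (1 + (NormedSpace.exp Y).trace.re) := by positivity
  exact_mod_cast this

/-- The slack carries the normalising constant, which is why the score can be recovered from the
play. -/
theorem sub_re_trace_expStep (hY : Y.IsHermitian) :
    a - (expStep a Y).trace.re = a / (1 + (NormedSpace.exp Y).trace.re) := by
  have := re_trace_exp_nonneg hY
  rw [expStep_eq hY, Matrix.trace_smul, Complex.smul_re, smul_eq_mul]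
  field_simp
  ring

theorem re_trace_expStep_lt (ha : 0 < a) (hY : Y.IsHermitian) : (expStep a Y).trace.re < a := by
  have := re_trace_exp_nonneg hY
  have h1 : 0 < a / (1 + (NormedSpace.exp Y).trace.re) := by positivity
  rw [← sub_re_trace_expStep hY] at h1
  linarith

theorem log_expStep (ha : 0 < a) (hY : Y.IsHermitian) :
    CFC.log (expStep a Y) =
      algebraMap ℝ _ (Real.log a - Real.log (1 + (NormedSpace.exp Y).trace.re)) + Y := by
  have h := re_trace_exp_nonneg hY
  have hY' : IsSelfAdjoint Y := hY
  have hE := posDef_exp hY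
  rw [expStep_eq hY, CFC.log_smul _ ?_ (by positivity) hE.isHermitian, CFC.log_exp Y hY',
    Real.log_div ha.ne' (by positivity)]
  rintro x hx rfl
  exact spectrum.zero_notMem ℝ (Matrix.isUnit_exp Y) hx

/-- The score is recovered from the exponential step. -/
theorem eq_log_expStep (ha : 0 < a) (hY : Y.IsHermitian) :
    Y = CFC.log (expStep a Y) -
      algebraMap ℝ _ (Real.log (a - (expStep a Y).trace.re)) := by
  have h := re_trace_exp_nonneg hY
  rw [log_expStep ha hY, sub_re_trace_expStep hY, Real.log_div ha.ne' (by positivity)]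
  simp

end ExpStep

/-- The divergence of a single block. -/
noncomputable def blockDivergence {m : ℕ} (a : ℝ) (P X : Matrix (Fin m) (Fin m) ℂ) : ℝ :=
  (Matrix.trace (P * (CFC.log P - CFC.log X))).re +
    (a - P.trace.re) * (Real.log (a - P.trace.re) - Real.log (a - X.trace.re))

/-- The negative entropy of a single block, including the slack. -/
noncomputable def blockEntropy {m : ℕ} (a : ℝ) (P : Matrix (Fin m) (Fin m) ℂ) : ℝ :=
  (Matrix.trace (P * CFC.log P)).re + (a - P.trace.re) * Real.log (a - P.trace.re) - a * Real.log a

/-- The scalar log-normaliser is weighted by `tr P` in the matrix term and by `a - tr P` in the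
slack term; the weights add up to `a`. -/
theorem blockDivergence_expStep {m : ℕ} {a : ℝ} {P Y : Matrix (Fin m) (Fin m) ℂ} (ha : 0 < a)
    (hY : Y.IsHermitian) : blockDivergence a P (expStep a Y) =
      blockEntropy a P + a * Real.log (1 + (NormedSpace.exp Y).trace.re) -
        (Matrix.trace (P * Y)).re := by
  have h := re_trace_exp_nonneg hY
  rw [blockDivergence, blockEntropy, sub_re_trace_expStep hY, log_expStep ha hY,
    Real.log_div ha.ne' (by positivity), mul_sub, mul_add, Matrix.trace_sub, Matrix.trace_add,
    Algebra.algebraMap_eq_smul_one, mul_smul_comm, mul_one, Matrix.trace_smul]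
  simp only [Complex.sub_re, Complex.add_re, Complex.smul_re, smul_eq_mul]
  ring

/-- The linear terms `- tr P + tr X` of Klein's inequality cancel against those of the scalar
inequality for the slacks, whose quadratic term is dropped. -/
theorem sq_norm_sub_le_blockDivergence {m : ℕ} {a : ℝ} {P X : Matrix (Fin m) (Fin m) ℂ}
    (ha : 0 < a) (hP : P ∈ actionSet m a) (hX : X.PosDef) (hXa : X.trace.re < a) :
    ‖P - X‖ ^ 2 ≤ 4 * a * blockDivergence a P X := by
  obtain ⟨hP, hPa⟩ := mem_actionSet_iff.1 hP
  have h1 := sq_div_le_re_trace_mul_log_sub hP hX hPa hXa.le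
  have hX0 : 0 ≤ X.trace.re := (Complex.nonneg_iff.1 hX.posSemidef.trace_nonneg).1
  have hP0 : 0 ≤ P.trace.re := (Complex.nonneg_iff.1 hP.trace_nonneg).1
  have h2 := sq_div_le_mul_log_sub (a := a) (p := a - P.trace.re) (x := a - X.trace.re)
    (by linarith) (by linarith) (by linarith) (by linarith)
  have h3 : 0 ≤ (a - P.trace.re - (a - X.trace.re)) ^ 2 / (4 * a) := by positivity
  have h4 : (Matrix.trace ((P - X) * (P - X))).re / (4 * a) ≤ blockDivergence a P X := by
    rw [blockDivergence]
    linarith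
  rw [div_le_iff₀ (by positivity)] at h4
  linarith [sq_norm_le_re_trace_mul_self (hP.isHermitian.sub hX.isHermitian)]

/-! ### Fenchel coupling, three-point identity and Lipschitz exponential step -/

section ProfileGeometry

variable {ι : Type*} [Fintype ι] {d : ι → ℕ}

/-- The trace pairing as a continuous bilinear map. -/
noncomputable def tracePairingCLM (d : ι → ℕ) : Profile d →L[ℝ] Profile d →L[ℝ] ℝ :=
  LinearMap.toContinuousBilinearMap <| LinearMap.mk₂ ℝ tracePairing
    (fun X X' V => by
      simp [tracePairing, add_mul, Finset.sum_add_distrib])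
    (fun c X V => by
      simp [tracePairing, Finset.mul_sum])
    (fun X V V' => by
      simp [tracePairing, mul_add, Finset.sum_add_distrib])
    (fun c X V => by
      simp [tracePairing, Finset.mul_sum])

theorem tracePairingCLM_apply (X V : Profile d) : tracePairingCLM d X V = tracePairing X V := rfl

theorem abs_tracePairing_le (X V : Profile d) :
    |tracePairing X V| ≤ ‖tracePairingCLM d‖ * ‖X‖ * ‖V‖ :=
  (tracePairingCLM d).le_opNorm₂ X V

/-- The relative interior of the feasible region: positive definite blocks and positive slacks. -/
def interiorProfiles (A : ι → ℝ) : Set (Profile d) :=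
  {X | ∀ i, (X i).PosDef ∧ (Matrix.trace (X i)).re < A i}

variable {A : ι → ℝ}

omit [Fintype ι] in
theorem interiorProfiles_subset_feasible : interiorProfiles (d := d) A ⊆ feasible A :=
  fun _ hX i => mem_actionSet_iff.2 ⟨(hX i).1.posSemidef, (hX i).2.le⟩

omit [Fintype ι] in
theorem mirrorMap_mem_interiorProfiles (hA : ∀ i, 0 < A i) {Y : Profile d}
    (hY : ∀ i, (Y i).IsHermitian) : mirrorMap A Y ∈ interiorProfiles A :=
  fun i => ⟨posDef_expStep (hA i) (hY i), re_trace_expStep_lt (hA i) (hY i)⟩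

omit [Fintype ι] in
theorem mirrorMap_mem_feasible (hA : ∀ i, 0 < A i) {Y : Profile d}
    (hY : ∀ i, (Y i).IsHermitian) : mirrorMap A Y ∈ feasible A :=
  interiorProfiles_subset_feasible (mirrorMap_mem_interiorProfiles hA hY)

omit [Fintype ι] in
theorem isCompact_feasible (A : ι → ℝ) : IsCompact (feasible (d := d) A) := by
  have h : feasible (d := d) A = Set.univ.pi fun i => actionSet (d i) (A i) := by
    ext X
    simp [feasible]
  rw [h]
  exact isCompact_univ_pi fun i => isCompact_actionSet (d i) (A i)

theorem klDivergence_eq_sum (P X : Profile d) :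
    klDivergence A P X = ∑ i, blockDivergence (A i) (P i) (X i) := rfl

theorem klDivergence_self (X : Profile d) : klDivergence A X X = 0 := by
  simp [klDivergence]

/-- The divergence dominates the squared distance. -/
theorem sq_norm_sub_le_klDivergence (hA : ∀ i, 0 < A i) {P X : Profile d} (hP : P ∈ feasible A)
    (hX : X ∈ interiorProfiles A) : ‖P - X‖ ^ 2 ≤ 4 * (∑ i, A i) * klDivergence A P X := by
  have h1 : ∀ i, ‖P i - X i‖ ^ 2 ≤ 4 * A i * blockDivergence (A i) (P i) (X i) := fun i =>
    sq_norm_sub_le_blockDivergence (hA i) (hP i) (hX i).1 (hX i).2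
  have h2 : ∀ i, 0 ≤ blockDivergence (A i) (P i) (X i) := fun i => by
    have h3 := (sq_nonneg _).trans (h1 i)
    have h4 := hA i
    by_contra h5
    push Not at h5
    nlinarith
  have hS : 0 ≤ ∑ i, A i := Finset.sum_nonneg fun i _ => (hA i).le
  have hD : 0 ≤ klDivergence A P X := Finset.sum_nonneg fun i _ => h2 i
  have hR : 0 ≤ 4 * (∑ i, A i) * klDivergence A P X := by positivity
  refine (Real.le_sqrt (norm_nonneg _) hR).1 ((pi_norm_le_iff_of_nonneg (Real.sqrt_nonneg _)).2
    fun i => (Real.le_sqrt (norm_nonneg _) hR).2 ((h1 i).trans ?_))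
  have h6 : A i ≤ ∑ i, A i := Finset.single_le_sum (fun i _ => (hA i).le) (Finset.mem_univ i)
  have h7 : blockDivergence (A i) (P i) (X i) ≤ klDivergence A P X :=
    Finset.single_le_sum (f := fun i => blockDivergence (A i) (P i) (X i))
      (fun i _ => h2 i) (Finset.mem_univ i)
  have := hA i
  have := h2 i
  gcongr

/-- The log-partition function generating the exponential step. -/
noncomputable def logPartition (A : ι → ℝ) (Y : Profile d) : ℝ :=
  ∑ i, A i * Real.log (1 + (NormedSpace.exp (Y i)).trace.re)

/-- The divergence to an exponential step is a Fenchel coupling. -/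
theorem klDivergence_mirrorMap (hA : ∀ i, 0 < A i) {P Y : Profile d}
    (hY : ∀ i, (Y i).IsHermitian) : klDivergence A P (mirrorMap A Y) =
      ∑ i, blockEntropy (A i) (P i) + logPartition A Y - tracePairing P Y := by
  rw [klDivergence_eq_sum, logPartition, tracePairing, ← Finset.sum_add_distrib,
    ← Finset.sum_sub_distrib]
  exact Finset.sum_congr rfl fun i _ => blockDivergence_expStep (hA i) (hY i)

/-- The three-point identity of the divergence. -/
theorem klDivergence_mirrorMap_sub (hA : ∀ i, 0 < A i) {P Y Y' : Profile d}
    (hY : ∀ i, (Y i).IsHermitian) (hY' : ∀ i, (Y' i).IsHermitian) :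
    klDivergence A P (mirrorMap A Y') = klDivergence A P (mirrorMap A Y) +
      tracePairing (mirrorMap A Y - P) (Y' - Y) +
        klDivergence A (mirrorMap A Y) (mirrorMap A Y') := by
  -- The vanishing self-divergence expresses the entropy of `mirrorMap A Y` through `Y`, eliminating
  -- it from the identity.
  have h := klDivergence_self (A := A) (mirrorMap A Y)
  rw [klDivergence_mirrorMap hA hY] at h ⊢
  rw [klDivergence_mirrorMap hA hY', klDivergence_mirrorMap hA hY']
  simp only [← tracePairingCLM_apply, map_sub, sub_apply] at h ⊢
  linarith

theorem klDivergence_mirrorMap_nonneg (hA : ∀ i, 0 < A i) {P Y : Profile d}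
    (hP : P ∈ feasible A) (hY : ∀ i, (Y i).IsHermitian) :
    0 ≤ klDivergence A P (mirrorMap A Y) := by
  have h := sq_norm_sub_le_klDivergence hA hP (mirrorMap_mem_interiorProfiles hA hY)
  rcases isEmpty_or_nonempty ι with hι | hι
  · simp [klDivergence]
  · have hS : 0 < ∑ i, A i := Finset.sum_pos (fun i _ => hA i) Finset.univ_nonempty
    by_contra h1
    push Not at h1
    nlinarith [sq_nonneg ‖P - mirrorMap A Y‖]

/-- The Lipschitz constant of the exponential step. -/
noncomputable def mirrorLipschitz (d : ι → ℕ) (A : ι → ℝ) : ℝ :=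
  2 * (∑ i, A i) * ‖tracePairingCLM d‖

theorem mirrorLipschitz_nonneg (hA : ∀ i, 0 < A i) : 0 ≤ mirrorLipschitz d A := by
  have hS : 0 ≤ ∑ i, A i := Finset.sum_nonneg fun i _ => (hA i).le
  rw [mirrorLipschitz]
  positivity

/-- The symmetrised divergence of two plays equals `⟨X' - X, Y' - Y⟩`; bounding it below
quadratically and above by the norm of the pairing leaves a linear estimate. -/
theorem norm_mirrorMap_sub_le (hA : ∀ i, 0 < A i) {Y Y' : Profile d}
    (hY : ∀ i, (Y i).IsHermitian) (hY' : ∀ i, (Y' i).IsHermitian) :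
    ‖mirrorMap A Y' - mirrorMap A Y‖ ≤ mirrorLipschitz d A * ‖Y' - Y‖ := by
  have hS : 0 ≤ ∑ i, A i := Finset.sum_nonneg fun i _ => (hA i).le
  have h1 := sq_norm_sub_le_klDivergence hA (mirrorMap_mem_feasible hA hY)
    (mirrorMap_mem_interiorProfiles hA hY')
  have h2 := sq_norm_sub_le_klDivergence hA (mirrorMap_mem_feasible hA hY')
    (mirrorMap_mem_interiorProfiles hA hY)
  have h3 := klDivergence_mirrorMap_sub hA (P := mirrorMap A Y') hY hY'
  rw [klDivergence_self] at h3
  have h4 := abs_tracePairing_le (mirrorMap A Y' - mirrorMap A Y) (Y' - Y)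
  have h5 : tracePairing (mirrorMap A Y - mirrorMap A Y') (Y' - Y) =
      - tracePairing (mirrorMap A Y' - mirrorMap A Y) (Y' - Y) := by
    rw [← neg_sub, ← tracePairingCLM_apply, map_neg]
    rfl
  rw [norm_sub_rev] at h1
  set Δ := ‖mirrorMap A Y' - mirrorMap A Y‖
  have h6 : 2 * Δ ^ 2 ≤ 4 * (∑ i, A i) * (‖tracePairingCLM d‖ * Δ * ‖Y' - Y‖) :=
    calc 2 * Δ ^ 2 ≤ 4 * (∑ i, A i) * (klDivergence A (mirrorMap A Y) (mirrorMap A Y') +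
          klDivergence A (mirrorMap A Y') (mirrorMap A Y)) := by linarith
      _ ≤ _ := by
        gcongr
        linarith [le_abs_self (tracePairing (mirrorMap A Y' - mirrorMap A Y) (Y' - Y))]
  rcases (norm_nonneg _ : 0 ≤ Δ).eq_or_lt with h7 | h7
  · refine h7.symm.trans_le ?_
    exact mul_nonneg (mirrorLipschitz_nonneg hA) (norm_nonneg _)
  · rw [mirrorLipschitz]
    refine le_of_mul_le_mul_right (a := 2 * Δ) ?_ (by positivity)
    linarith

/-- One-step growth of the divergence along the exponential step. -/
theorem klDivergence_mirrorMap_add_le (hA : ∀ i, 0 < A i) {P Y W : Profile d}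
    (hY : ∀ i, (Y i).IsHermitian) (hW : ∀ i, (W i).IsHermitian) :
    klDivergence A P (mirrorMap A (Y + W)) ≤ klDivergence A P (mirrorMap A Y) +
      tracePairing (mirrorMap A Y - P) W +
        ‖tracePairingCLM d‖ * mirrorLipschitz d A * ‖W‖ ^ 2 := by
  have hYW : ∀ i, ((Y + W) i).IsHermitian := fun i => (hY i).add (hW i)
  have h1 := klDivergence_mirrorMap_sub hA (P := P) hY hYW
  -- Taking the new play as base point bounds the Bregman remainder by `⟨X⁺ - X, W⟩`, which is
  -- quadratic in `W` by the Lipschitz estimate.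
  have h2 := klDivergence_mirrorMap_sub hA (P := mirrorMap A (Y + W)) hY hYW
  have h3 := klDivergence_mirrorMap_nonneg hA (mirrorMap_mem_feasible hA hYW) hY
  have h4 := abs_tracePairing_le (mirrorMap A Y - mirrorMap A (Y + W)) W
  have h5 := norm_mirrorMap_sub_le hA hY hYW
  rw [klDivergence_self] at h2
  rw [norm_sub_rev] at h4
  rw [add_sub_cancel_left] at h1 h2 h5
  have h6 : ‖tracePairingCLM d‖ * ‖mirrorMap A (Y + W) - mirrorMap A Y‖ * ‖W‖ ≤
      ‖tracePairingCLM d‖ * (mirrorLipschitz d A * ‖W‖) * ‖W‖ := by gcongr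
  have h7 := neg_abs_le (tracePairing (mirrorMap A Y - mirrorMap A (Y + W)) W)
  nlinarith

end ProfileGeometry

/-! ### Continuity, measurability and neighbourhoods of the divergence -/

section DivergenceTopology

variable {ι : Type*} [Fintype ι] {d : ι → ℕ} {A : ι → ℝ}

theorem continuousOn_log_posDef {m : ℕ} :
    ContinuousOn (CFC.log : Matrix (Fin m) (Fin m) ℂ → _) {X | X.PosDef} :=
  CFC.continuousOn_log.mono fun _ hX => ⟨hX.isHermitian, hX.isUnit⟩

omit [Fintype ι] in
theorem continuousOn_block_log (i : ι) :
    ContinuousOn (fun X : Profile d => CFC.log (X i)) (interiorProfiles A) :=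
  continuousOn_log_posDef.comp (continuous_apply i).continuousOn fun _ hX => (hX i).1

omit [Fintype ι] in
theorem continuous_re_trace_block (i : ι) : Continuous fun X : Profile d => (X i).trace.re := by
  fun_prop

omit [Fintype ι] in
theorem continuousOn_log_slack (i : ι) :
    ContinuousOn (fun X : Profile d => Real.log (A i - (X i).trace.re)) (interiorProfiles A) :=
  (continuousOn_const.sub (continuous_re_trace_block i).continuousOn).log
    fun _ hX => (sub_pos.2 (hX i).2).ne'

theorem continuousOn_klDivergence (P : Profile d) :
    ContinuousOn (klDivergence A P) (interiorProfiles A) := by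
  refine continuousOn_finsetSum _ fun i _ => ?_
  have h1 := continuousOn_block_log (d := d) (A := A) i
  have h2 := continuousOn_log_slack (d := d) (A := A) i
  have h3 : Continuous fun M : Matrix (Fin (d i)) (Fin (d i)) ℂ =>
    (Matrix.trace (P i * (CFC.log (P i) - M))).re := by fun_prop
  exact (h3.comp_continuousOn h1).add (continuousOn_const.mul (continuousOn_const.sub h2))

/-- The score profile recovered from an interior play. -/
noncomputable def scoreOf (A : ι → ℝ) (X : Profile d) : Profile d := fun i =>
  CFC.log (X i) - algebraMap ℝ _ (Real.log (A i - (X i).trace.re))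

omit [Fintype ι] in
theorem scoreOf_mirrorMap (hA : ∀ i, 0 < A i) {Y : Profile d} (hY : ∀ i, (Y i).IsHermitian) :
    scoreOf A (mirrorMap A Y) = Y :=
  funext fun i => (eq_log_expStep (hA i) (hY i)).symm

omit [Fintype ι] in
theorem continuousOn_scoreOf : ContinuousOn (scoreOf (d := d) A) (interiorProfiles A) := by
  refine continuousOn_pi.2 fun i => (continuousOn_block_log i).sub ?_
  exact (continuous_algebraMap ℝ _).comp_continuousOn (continuousOn_log_slack i)

/-- Among positive semidefinite matrices, definiteness is the open condition `det ≠ 0`. -/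
theorem exists_isOpen_interiorProfiles :
    ∃ O : Set (Profile d), IsOpen O ∧ interiorProfiles A = feasible A ∩ O := by
  refine ⟨⋂ i, {X | (X i).det ≠ 0 ∧ (X i).trace.re < A i}, isOpen_iInter_of_finite fun i => ?_, ?_⟩
  · have h1 : IsOpen {X : Profile d | (X i).det ≠ 0} :=
      isOpen_ne_fun (by fun_prop) continuous_const
    have h2 : IsOpen {X : Profile d | (X i).trace.re < A i} :=
      isOpen_lt (continuous_re_trace_block i) continuous_const
    exact h1.inter h2
  · ext X
    simp only [interiorProfiles, feasible, Set.mem_inter_iff, Set.mem_iInter, ← forall_and,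
      Set.mem_ofPred_eq, mem_actionSet_iff]
    refine forall_congr' fun i => ⟨fun h => ⟨⟨h.1.posSemidef, h.2.le⟩, ?_, h.2⟩, fun h => ⟨?_, h.2.2⟩⟩
    · exact h.1.det_pos.ne'
    · rw [h.1.1.posDef_iff_isUnit, Matrix.isUnit_iff_isUnit_det]
      exact h.2.1.isUnit

/-- The feasible profiles which, if interior, have divergence less than `m` from `P`. -/
def divergenceBall (A : ι → ℝ) (P : Profile d) (m : ℝ) : Set (Profile d) :=
  {X | X ∈ feasible A ∧ (X ∈ interiorProfiles A → klDivergence A P X < m)}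

theorem measurableSet_divergenceBall (P : Profile d) (m : ℝ) :
    MeasurableSet[borel (Profile d)] (divergenceBall A P m) := by
  borelize (Profile d)
  obtain ⟨O, hO, hIeq⟩ := exists_isOpen_interiorProfiles (d := d) (A := A)
  have hF : MeasurableSet (feasible (d := d) A) := (isCompact_feasible A).isClosed.measurableSet
  have hI : MeasurableSet (interiorProfiles (d := d) A) := hIeq ▸ hF.inter hO.measurableSet
  obtain ⟨V, hV, hIV⟩ := (continuousOn_iff'.1 (continuousOn_klDivergence (A := A) P))
    (Set.Iio m) isOpen_Iio
  -- Continuity of the divergence is available only on the interior; there the ball is cut out by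
  -- `V`, elsewhere it is all of the feasible set.
  have h : divergenceBall A P m = feasible A \ (interiorProfiles A \ V) := by
    ext X
    have h1 : X ∈ interiorProfiles A → (klDivergence A P X < m ↔ X ∈ V) := fun hX => by
      have := Set.ext_iff.1 hIV X
      simpa [hX] using this
    simp only [divergenceBall, Set.mem_ofPred_eq, Set.mem_sdiff]
    tauto
  rw [h]
  exact hF.diff (hI.diff hV.measurableSet)

theorem isDivergenceNhd_divergenceBall [DecidableEq ι] {P : Profile d} (hP : P ∈ feasible A) {m : ℝ}
    (hm : 0 < m) : IsDivergenceNhd A P (divergenceBall A P m) :=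
  ⟨⟨hP, fun _ => by rwa [klDivergence_self]⟩, m, hm, fun _ hX hD =>
    ⟨interiorProfiles_subset_feasible hX, fun _ => hD⟩⟩

/-- A zero block annihilates its trace term, a definite one is a continuity point of the logarithm,
and a zero slack annihilates the slack term. For a singular nonzero block the limit can fail:
eigenvectors may rotate towards their limit while an eigenvalue vanishes much faster. -/
theorem tendsto_klDivergence {P : Profile d} (hP : ∀ i, P i = 0 ∨ (P i).PosDef) :
    Tendsto (klDivergence A P) (𝓝[interiorProfiles A] P) (𝓝 0) := by
  rw [← klDivergence_self (A := A) P]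
  refine tendsto_finsetSum _ fun i _ => Tendsto.add ?_ ?_
  · rcases hP i with h | h
    · simp only [h, zero_mul]
      exact tendsto_const_nhds
    · have h1 : Tendsto (fun X : Profile d => X i) (𝓝[interiorProfiles A] P)
          (𝓝[{X | X.PosDef}] (P i)) :=
        (continuous_apply i).continuousWithinAt.tendsto_nhdsWithin fun _ hX => (hX i).1
      have h2 := (continuousOn_log_posDef (P i) h).tendsto.comp h1
      have h3 : Continuous fun M : Matrix (Fin (d i)) (Fin (d i)) ℂ =>
        (Matrix.trace (P i * (CFC.log (P i) - M))).re := by fun_prop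
      exact (h3.tendsto _).comp h2
  · by_cases h : A i - (P i).trace.re = 0
    · simp only [h, zero_mul]
      exact tendsto_const_nhds
    · have h1 : ContinuousAt (fun X : Profile d => Real.log (A i - (X i).trace.re)) P :=
        (continuousAt_const.sub (continuous_re_trace_block i).continuousAt).log h
      exact ((tendsto_const_nhds.sub h1.tendsto).const_mul _).mono_left nhdsWithin_le_nhds

theorem divergenceBall_mem_nhdsWithin {P : Profile d} (hP : ∀ i, P i = 0 ∨ (P i).PosDef)
    {m : ℝ} (hm : 0 < m) : divergenceBall A P m ∈ 𝓝[feasible A] P := by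
  have h1 := (tendsto_klDivergence (A := A) hP).eventually (gt_mem_nhds hm)
  rw [eventually_nhdsWithin_iff] at h1
  filter_upwards [nhdsWithin_le_nhds h1, self_mem_nhdsWithin] with X hX hF using ⟨hF, hX⟩

end DivergenceTopology

/-! ### Square-integrable martingale differences and conditioning -/

section MartingaleDifferences

/-- Square-integrable real martingale differences `x n` with respect to `ℱ`. -/
structure IsL2MartingaleDiff {Ω : Type*} {m0 : MeasurableSpace Ω} (μ : Measure Ω)
    (ℱ : Filtration ℕ m0) (x : ℕ → Ω → ℝ) : Prop where
  stronglyMeasurable : ∀ n, StronglyMeasurable[ℱ (n + 1)] (x n)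
  memLp : ∀ n, MemLp (x n) 2 μ
  condExp : ∀ n, μ[x n | ℱ n] =ᵐ[μ] 0

namespace IsL2MartingaleDiff

variable {Ω : Type*} {m0 : MeasurableSpace Ω} {μ : Measure Ω} [IsFiniteMeasure μ]
  {ℱ : Filtration ℕ m0} {x : ℕ → Ω → ℝ}

omit [IsFiniteMeasure μ] in
theorem stronglyMeasurable_sum (hx : IsL2MartingaleDiff μ ℱ x) (n : ℕ) :
    StronglyMeasurable[ℱ n] fun ω => ∑ k ∈ Finset.range n, x k ω :=
  Finset.stronglyMeasurable_fun_sum _ fun k hk =>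
    (hx.stronglyMeasurable k).mono (ℱ.mono (Finset.mem_range.1 hk))

omit [IsFiniteMeasure μ] in
theorem memLp_sum (hx : IsL2MartingaleDiff μ ℱ x) (n : ℕ) :
    MemLp (fun ω => ∑ k ∈ Finset.range n, x k ω) 2 μ :=
  memLp_finsetSum _ fun k _ => hx.memLp k

theorem integrable_sum (hx : IsL2MartingaleDiff μ ℱ x) (n : ℕ) :
    Integrable (fun ω => ∑ k ∈ Finset.range n, x k ω) μ :=
  (hx.memLp_sum n).integrable one_le_two

theorem martingale_sum (hx : IsL2MartingaleDiff μ ℱ x) :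
    Martingale (fun n ω => ∑ k ∈ Finset.range n, x k ω) ℱ μ := by
  refine martingale_of_condExp_sub_eq_zero_nat hx.stronglyMeasurable_sum hx.integrable_sum
    fun n => ?_
  have h : (fun ω => ∑ k ∈ Finset.range (n + 1), x k ω) - (fun ω => ∑ k ∈ Finset.range n, x k ω) =
      x n := by
    ext ω
    simp [Finset.sum_range_succ]
  rw [h]
  exact hx.condExp n

/-- The cross term has zero conditional mean. Arbitrary `s` serves the submartingale property, `s =
univ` the variance bound. -/
theorem setIntegral_sum_sq_succ (hx : IsL2MartingaleDiff μ ℱ x) (n : ℕ) {s : Set Ω}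
    (hs : MeasurableSet[ℱ n] s) :
    ∫ ω in s, (∑ k ∈ Finset.range (n + 1), x k ω) ^ 2 ∂μ =
      ∫ ω in s, (∑ k ∈ Finset.range n, x k ω) ^ 2 ∂μ + ∫ ω in s, x n ω ^ 2 ∂μ := by
  have hS := hx.memLp_sum n
  have hi : Integrable ((fun ω => ∑ k ∈ Finset.range n, x k ω) * x n) μ :=
    hS.integrable_mul (hx.memLp n)
  have h0 : ∫ ω in s, ((fun ω => ∑ k ∈ Finset.range n, x k ω) * x n) ω ∂μ = 0 := by
    rw [← setIntegral_condExp (ℱ.le n) hi hs]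
    have h1 := condExp_mul_of_stronglyMeasurable_left (hx.stronglyMeasurable_sum n) hi
      ((hx.memLp n).integrable one_le_two)
    have h2 : (μ[(fun ω => ∑ k ∈ Finset.range n, x k ω) * x n | ℱ n]) =ᵐ[μ] 0 := by
      filter_upwards [h1, hx.condExp n] with ω h3 h4
      rw [h3, Pi.mul_apply, h4]
      simp
    rw [setIntegral_congr_ae (g := fun _ => 0) (ℱ.le n _ hs) (h2.mono fun ω h _ => h)]
    simp
  have h3 : ∀ ω, (∑ k ∈ Finset.range (n + 1), x k ω) ^ 2 =
      (∑ k ∈ Finset.range n, x k ω) ^ 2 + x n ω ^ 2 +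
        2 * ((fun ω => ∑ k ∈ Finset.range n, x k ω) * x n) ω := by
    intro ω
    rw [Finset.sum_range_succ, Pi.mul_apply]
    ring
  simp_rw [h3]
  have h4 : Integrable (fun ω => (∑ k ∈ Finset.range n, x k ω) ^ 2 + x n ω ^ 2) μ :=
    hS.integrable_sq.add (hx.memLp n).integrable_sq
  rw [integral_add h4.integrableOn (hi.const_mul 2).integrableOn,
    integral_add hS.integrable_sq.integrableOn (hx.memLp n).integrable_sq.integrableOn,
    integral_const_mul, h0]
  ring

theorem submartingale_sum_sq (hx : IsL2MartingaleDiff μ ℱ x) :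
    Submartingale (fun n ω => (∑ k ∈ Finset.range n, x k ω) ^ 2) ℱ μ := by
  refine submartingale_of_setIntegral_le_succ (fun n => (hx.stronglyMeasurable_sum n).pow 2)
    (fun n => (hx.memLp_sum n).integrable_sq) fun n s hs => ?_
  rw [hx.setIntegral_sum_sq_succ n hs]
  exact le_add_of_nonneg_right (integral_nonneg fun ω => sq_nonneg _)

theorem integral_sum_sq_le (hx : IsL2MartingaleDiff μ ℱ x) {b : ℕ → ℝ} (hb : Summable b)
    (hxb : ∀ n, ∫ ω, x n ω ^ 2 ∂μ ≤ b n) (n : ℕ) :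
    ∫ ω, (∑ k ∈ Finset.range n, x k ω) ^ 2 ∂μ ≤ ∑' k, b k := by
  have h0 : ∀ n, 0 ≤ b n := fun n => (integral_nonneg fun ω => sq_nonneg _).trans (hxb n)
  refine le_trans ?_ (hb.sum_le_tsum (Finset.range n) fun k _ => h0 k)
  induction n with
  | zero => simp
  | succ n ih =>
    have h := hx.setIntegral_sum_sq_succ n MeasurableSet.univ
    simp only [setIntegral_univ] at h
    rw [h, Finset.sum_range_succ]
    exact add_le_add ih (hxb n)

/-- Maximal inequality over an infinite horizon. -/
theorem measure_exists_le_abs_sum_le (hx : IsL2MartingaleDiff μ ℱ x) {b : ℕ → ℝ} (hb : Summable b)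
    (hxb : ∀ n, ∫ ω, x n ω ^ 2 ∂μ ≤ b n) {a : ℝ} (ha : 0 < a) :
    μ {ω | ∃ n, a ≤ |∑ k ∈ Finset.range n, x k ω|} ≤ ENNReal.ofReal ((∑' k, b k) / a ^ 2) := by
  -- The event is an increasing union of finite-horizon events, each handled by Doob's inequality
  -- for the squared sums at level `a ^ 2`.
  have h1 : {ω | ∃ n, a ≤ |∑ k ∈ Finset.range n, x k ω|} =
      ⋃ n, {ω | ∃ k ≤ n, a ≤ |∑ j ∈ Finset.range k, x j ω|} := by
    ext ω
    simp only [Set.mem_ofPred_eq, Set.mem_iUnion]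
    exact ⟨fun ⟨n, hn⟩ => ⟨n, n, le_rfl, hn⟩, fun ⟨_, k, _, hk⟩ => ⟨k, hk⟩⟩
  have hmono : Monotone fun n => {ω | ∃ k ≤ n, a ≤ |∑ j ∈ Finset.range k, x j ω|} :=
    fun n m hnm ω ⟨k, hk, h⟩ => ⟨k, hk.trans hnm, h⟩
  rw [h1, hmono.measure_iUnion]
  refine iSup_le fun n => ?_
  have h2 : ENNReal.ofReal (a ^ 2) * μ {ω | ∃ k ≤ n, a ≤ |∑ j ∈ Finset.range k, x j ω|} ≤
      ENNReal.ofReal (∫ ω in {ω | ∃ k ≤ n, a ≤ |∑ j ∈ Finset.range k, x j ω|},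
        (∑ k ∈ Finset.range n, x k ω) ^ 2 ∂μ) := by
    have h3 : {ω | ∃ k ≤ n, a ≤ |∑ j ∈ Finset.range k, x j ω|} =
        {ω | ((a ^ 2).toNNReal : ℝ) ≤ (Finset.range (n + 1)).sup'
          Finset.nonempty_range_add_one fun k => (∑ j ∈ Finset.range k, x j ω) ^ 2} := by
      ext ω
      simp only [Set.mem_ofPred_eq, Real.coe_toNNReal _ (sq_nonneg a), Finset.le_sup'_iff,
        Finset.mem_range, Nat.lt_succ_iff]
      refine exists_congr fun k => and_congr_right fun _ => ?_
      rw [← sq_abs (∑ j ∈ Finset.range k, x j ω),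
        pow_le_pow_iff_left₀ ha.le (abs_nonneg _) two_ne_zero]
    rw [h3]
    exact maximal_ineq hx.submartingale_sum_sq (fun n ω => sq_nonneg _) n
  rw [ENNReal.ofReal_div_of_pos (by positivity), ENNReal.le_div_iff_mul_le
    (Or.inl (by simpa using ha.ne')) (Or.inl ENNReal.ofReal_ne_top), mul_comm]
  refine h2.trans (ENNReal.ofReal_le_ofReal ?_)
  refine (setIntegral_le_integral (hx.memLp_sum n).integrable_sq
    (ae_of_all _ fun ω => sq_nonneg _)).trans (hx.integral_sum_sq_le hb hxb n)

/-- The variance bound controls the `L¹` norms through `|s| ≤ 1 + s²`, so martingale convergence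
applies. -/
theorem ae_exists_tendsto_sum (hx : IsL2MartingaleDiff μ ℱ x) {b : ℕ → ℝ} (hb : Summable b)
    (hxb : ∀ n, ∫ ω, x n ω ^ 2 ∂μ ≤ b n) :
    ∀ᵐ ω ∂μ, ∃ c, Tendsto (fun n => ∑ k ∈ Finset.range n, x k ω) atTop (𝓝 c) := by
  refine hx.martingale_sum.submartingale.exists_ae_tendsto_of_bdd
    (R := Real.toNNReal (μ.real Set.univ + ∑' k, b k)) fun n => ?_
  rw [eLpNorm_one_eq_lintegral_enorm, ← ofReal_integral_norm_eq_lintegral_enorm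
    (hx.integrable_sum n), ← ENNReal.ofReal]
  refine ENNReal.ofReal_le_ofReal ?_
  calc ∫ ω, ‖∑ k ∈ Finset.range n, x k ω‖ ∂μ
      ≤ ∫ ω, (1 + (∑ k ∈ Finset.range n, x k ω) ^ 2) ∂μ := by
        refine integral_mono (hx.integrable_sum n).norm
          ((integrable_const _).add (hx.memLp_sum n).integrable_sq) fun ω => ?_
        simp only [Real.norm_eq_abs]
        rw [← sq_abs]
        nlinarith [sq_nonneg (|∑ k ∈ Finset.range n, x k ω| - 1)]
    _ ≤ _ := by
        rw [integral_add (integrable_const _) (hx.memLp_sum n).integrable_sq]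
        simp only [integral_const, smul_eq_mul, mul_one]
        gcongr
        exact hx.integral_sum_sq_le hb hxb n

end IsL2MartingaleDiff

/-- Zero conditional mean is preserved by conditioning on an event of the `σ`-algebra. -/
theorem condExp_cond_eq_zero {Ω E : Type*} [NormedAddCommGroup E] [NormedSpace ℝ E]
    [CompleteSpace E] {m m0 : MeasurableSpace Ω} (hm : m ≤ m0) {μ : Measure Ω} [IsFiniteMeasure μ]
    {f : Ω → E} (hf : Integrable f μ) (h0 : μ[f | m] =ᵐ[μ] 0) {s : Set Ω}
    (hs : MeasurableSet[m] s) : (μ[|s])[f | m] =ᵐ[μ[|s]] 0 := by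
  have hfs : Integrable f (μ[|s]) := by
    by_cases h : μ s = 0
    · rw [cond_eq_zero_of_meas_eq_zero h]
      exact integrable_zero_measure
    · exact hf.restrict.smul_measure (ENNReal.inv_ne_top.2 h)
  refine (ae_eq_condExp_of_forall_setIntegral_eq hm hfs
    (fun _ _ _ => (integrable_zero _ _ _).integrableOn) (fun t ht _ => ?_)
    stronglyMeasurable_zero.aestronglyMeasurable).symm
  rw [ProbabilityTheory.cond, Measure.restrict_smul, Measure.restrict_restrict (hm _ ht),
    integral_smul_measure, integral_smul_measure, ← setIntegral_condExp hm hf (ht.inter hs),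
    setIntegral_congr_ae (g := fun _ => 0) (hm _ (ht.inter hs)) (h0.mono fun ω h _ => h)]
  simp

/-- Since `s` belongs to `m`, `f` and its conditional expectation have the same integral over `s`.
-/
theorem integral_cond_le {Ω : Type*} {m m0 : MeasurableSpace Ω} (hm : m ≤ m0) {μ : Measure Ω}
    [IsFiniteMeasure μ] {f : Ω → ℝ} (hf : Integrable f μ) {c : ℝ}
    (hc : ∀ᵐ ω ∂μ, (μ[f | m]) ω ≤ c) {s : Set Ω} (hs : MeasurableSet[m] s) (hs0 : μ s ≠ 0) :
    ∫ ω, f ω ∂(μ[|s]) ≤ c := by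
  have hs1 : 0 < μ.real s := ENNReal.toReal_pos hs0 (measure_ne_top _ _)
  have h1 : ∫ ω in s, f ω ∂μ ≤ μ.real s * c := by
    rw [← setIntegral_condExp hm hf hs]
    calc ∫ ω in s, (μ[f | m]) ω ∂μ ≤ ∫ _ in s, c ∂μ :=
          integral_mono_ae integrable_condExp.restrict (integrable_const _) (ae_restrict_of_ae hc)
      _ = _ := by simp
  rw [ProbabilityTheory.cond, integral_smul_measure, ENNReal.toReal_inv, smul_eq_mul,
    ← measureReal_def, inv_mul_le_iff₀ hs1]
  exact h1

end MartingaleDifferences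

/-! ### Convergence of a single trajectory -/

section DeterministicConvergence

/-- A trajectory in a compact set whose displacement is controlled by the elapsed step sizes and a
Cauchy sequence converges to the unique zero of a nonpositive function which is summable along it. -/
theorem tendsto_of_summable_step_mul {E : Type*} [NormedAddCommGroup E] {K : Set E}
    (hK : IsCompact K) {v : E → ℝ} (hv : ContinuousOn v K) {p : E}
    (hneg : ∀ x ∈ K, x ≠ p → v x < 0) (hle : ∀ x ∈ K, v x ≤ 0) {X : ℕ → E} (hX : ∀ n, X n ∈ K)
    {γ : ℕ → ℝ} (hγ : ∀ n, 0 < γ n)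
    (hγ0 : Tendsto γ atTop (𝓝 0)) (hγs : ¬ Summable γ) (hs : Summable fun n => γ n * v (X n))
    {F : Type*} [NormedAddCommGroup F] {W : ℕ → F} (hW : CauchySeq W) {L B : ℝ} (hL : 0 ≤ L)
    (hB : 0 ≤ B) (hd : ∀ n m, n ≤ m →
      ‖X m - X n‖ ≤ L * (B * ∑ k ∈ Finset.Ico n m, γ k + ‖W m - W n‖)) :
    Tendsto X atTop (𝓝 p) := by
  classical
  rw [Metric.tendsto_atTop]
  intro η hη
  obtain ⟨c, hc, hvc⟩ : ∃ c > 0, ∀ x ∈ K, η / 2 ≤ ‖x - p‖ → v x ≤ -c := by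
    have hK' : IsCompact (K ∩ {x | η / 2 ≤ ‖x - p‖}) :=
      hK.inter_right (isClosed_le continuous_const (by fun_prop))
    rcases (K ∩ {x | η / 2 ≤ ‖x - p‖}).eq_empty_or_nonempty with h | h
    · exact ⟨1, one_pos, fun x hx hxp => absurd (h ▸ ⟨hx, hxp⟩ : x ∈ (∅ : Set E)) id⟩
    · obtain ⟨y, hy, hmax⟩ := hK'.exists_isMaxOn h (hv.mono Set.inter_subset_left)
      refine ⟨-v y, neg_pos.2 (hneg y hy.1 ?_), fun x hx hxp => ?_⟩
      · rintro rfl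
        have h2 : η / 2 ≤ ‖y - y‖ := hy.2
        rw [sub_self, norm_zero] at h2
        linarith
      · simpa using hmax ⟨hx, hxp⟩
  -- The steps taken from outside the half-radius ball; they are summable because `v ≤ -c` there.
  set g : ℕ → ℝ := fun n => if η / 2 ≤ ‖X n - p‖ then γ n else 0 with hg
  have hg0 : ∀ n, 0 ≤ g n := fun n => by
    simp only [hg]
    split_ifs
    exacts [(hγ n).le, le_rfl]
  have hgs : Summable g := by
    refine Summable.of_nonneg_of_le hg0 (fun n => ?_) (hs.mul_left (-c⁻¹))
    have h1 := hle _ (hX n)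
    have h2 := hγ n
    have h3 : -c⁻¹ * (γ n * v (X n)) = γ n * (c⁻¹ * -v (X n)) := by ring
    rw [h3]
    simp only [hg]
    split_ifs with h
    · refine le_mul_of_one_le_right h2.le ?_
      rw [← div_eq_inv_mul, le_div_iff₀ hc]
      linarith [hvc _ (hX n) h]
    · have : 0 ≤ -v (X n) := by linarith
      positivity
  -- An excursion will use step size at most `2τ` and noise at most `τ`; this `τ` makes the
  -- resulting displacement smaller than `η / 2`.
  set τ : ℝ := η / 2 / ((L + 1) * (2 * B + 1)) with hτ
  have hτ0 : 0 < τ := by positivity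
  have hτL : L * (B * (τ + τ) + τ) < η / 2 := by
    have h1 : τ * ((L + 1) * (2 * B + 1)) = η / 2 := div_mul_cancel₀ _ (by positivity)
    nlinarith [mul_pos hτ0 (by positivity : 0 < 2 * B + 1)]
  obtain ⟨N1, hN1⟩ := Metric.cauchySeq_iff.1 hW τ hτ0
  obtain ⟨N2, hN2⟩ := Metric.cauchySeq_iff.1 hgs.hasSum.tendsto_sum_nat.cauchySeq τ hτ0
  obtain ⟨N3, hN3⟩ := eventually_atTop.1 (hγ0.eventually (gt_mem_nhds hτ0))
  -- Otherwise `g` and `γ` agree from some index on, and `γ` would be summable.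
  obtain ⟨n0, hn0, hn0'⟩ : ∃ n0 ≥ max N1 (max N2 N3), ‖X n0 - p‖ < η / 2 := by
    by_contra! h
    refine hγs ((summable_nat_add_iff (max N1 (max N2 N3))).1 ?_)
    refine ((summable_nat_add_iff (max N1 (max N2 N3))).2 hgs).congr fun n => ?_
    simp only [hg]
    rw [if_pos (h _ (Nat.le_add_left _ _))]
  -- The last visit to the half-radius ball before time `m`.
  have hlast : ∀ m ≥ n0, ∃ n, n0 ≤ n ∧ n ≤ m ∧ ‖X n - p‖ < η / 2 ∧
      ∀ k, n < k → k < m → η / 2 ≤ ‖X k - p‖ := by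
    intro m hm
    induction m, hm using Nat.le_induction with
    | base => exact ⟨n0, le_rfl, le_rfl, hn0', fun k h1 h2 => absurd h1 h2.not_gt⟩
    | succ m hm ih =>
      by_cases hmp : ‖X m - p‖ < η / 2
      · exact ⟨m, hm, Nat.le_succ m, hmp, fun k h1 h2 => by omega⟩
      · obtain ⟨n, h1, h2, h3, h4⟩ := ih
        refine ⟨n, h1, by omega, h3, fun k h5 h6 => ?_⟩
        rcases Nat.lt_succ_iff_lt_or_eq.1 h6 with h7 | rfl
        · exact h4 k h5 h7
        · exact not_lt.1 hmp
  refine ⟨n0, fun m hm => ?_⟩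
  obtain ⟨n, h1, h2, h3, h4⟩ := hlast m hm
  have hn1 : N1 ≤ n := (le_max_left _ _).trans (hn0.trans h1)
  have hn2 : N2 ≤ n := ((le_max_left _ _).trans (le_max_right _ _)).trans (hn0.trans h1)
  have hn3 : N3 ≤ n := ((le_max_right _ _).trans (le_max_right _ _)).trans (hn0.trans h1)
  have h5 : ∑ k ∈ Finset.Ico n m, γ k ≤ τ + τ := by
    -- The step at `n` starts inside the ball and is not counted by `g`; it contributes the second
    -- `τ`, being small itself.
    have h6 : ∀ k ∈ Finset.Ico n m, γ k ≤ g k + if k = n then γ n else 0 := by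
      intro k hk
      rw [Finset.mem_Ico] at hk
      by_cases hkn : k = n
      · subst hkn
        simp [hg0]
      · simp only [hg]
        rw [if_pos (h4 k (by omega) hk.2), if_neg hkn, add_zero]
    refine (Finset.sum_le_sum h6).trans ?_
    rw [Finset.sum_add_distrib]
    refine add_le_add ?_ ?_
    · rw [Finset.sum_Ico_eq_sub _ h2]
      exact (le_abs_self _).trans (hN2 m (hn2.trans h2) n hn2).le
    · rw [Finset.sum_ite_eq']
      split_ifs
      exacts [(hN3 n hn3).le, hτ0.le]
  have h7 : ‖W m - W n‖ ≤ τ := by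
    rw [← dist_eq_norm]
    exact (hN1 m (hn1.trans h2) n hn1).le
  have h8 : ‖X m - X n‖ ≤ L * (B * (τ + τ) + τ) := (hd n m h2).trans (by gcongr)
  rw [dist_eq_norm]
  calc ‖X m - p‖ = ‖X m - X n + (X n - p)‖ := by rw [sub_add_sub_cancel]
    _ ≤ ‖X m - X n‖ + ‖X n - p‖ := norm_add_le _ _
    _ < η := by linarith

end DeterministicConvergence

/-! ### Vector-valued noise -/

section VectorNoise

theorem MeasureTheory.StronglyMeasurable.comp_continuousOn {Ω E F : Type*} {m : MeasurableSpace Ω}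
    [TopologicalSpace E] [TopologicalSpace.PseudoMetrizableSpace E]
    [TopologicalSpace F] [TopologicalSpace.PseudoMetrizableSpace F] [SecondCountableTopology F]
    {g : Ω → E} (hg : StronglyMeasurable g) {f : E → F} {S : Set E} (hf : ContinuousOn f S)
    (hS : ∀ ω, g ω ∈ S) : StronglyMeasurable fun ω => f (g ω) := by
  borelize E F
  have h1 : Measurable fun ω => (⟨g ω, hS ω⟩ : S) := hg.measurable.subtype_mk
  have h2 : Continuous fun x : S => f x := continuousOn_iff_continuous_domRestrict.1 hf
  exact (h2.measurable.comp h1).stronglyMeasurable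

variable {Ω E : Type*} {m0 : MeasurableSpace Ω} {μ : Measure Ω} [IsProbabilityMeasure μ]
  {ℱ : Filtration ℕ m0} [NormedAddCommGroup E] [NormedSpace ℝ E] [CompleteSpace E]

/-- Square-integrable vector-valued martingale differences with second moments at most `s`. -/
structure IsBoundedNoise (μ : Measure Ω) (ℱ : Filtration ℕ m0) (s : ℝ) (Z : ℕ → Ω → E) : Prop where
  stronglyMeasurable : ∀ n, StronglyMeasurable[ℱ (n + 1)] (Z n)
  integrable : ∀ n, Integrable (Z n) μ
  condExp : ∀ n, μ[Z n | ℱ n] =ᵐ[μ] 0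
  integrable_sq : ∀ n, Integrable (fun ω => ‖Z n ω‖ ^ 2) μ
  integral_sq_le : ∀ n, ∫ ω, ‖Z n ω‖ ^ 2 ∂μ ≤ s

namespace IsBoundedNoise

variable {s : ℝ} {Z : ℕ → Ω → E}

omit [IsProbabilityMeasure μ] [CompleteSpace E] in
theorem nonneg (hZ : IsBoundedNoise μ ℱ s Z) : 0 ≤ s :=
  (integral_nonneg fun _ => sq_nonneg _).trans (hZ.integral_sq_le 0)

/-- Bounded predictable functionals of the noise are martingale differences. -/
theorem isL2MartingaleDiff (hZ : IsBoundedNoise μ ℱ s Z) (γ : ℕ → ℝ) {G : ℕ → Ω → E →L[ℝ] ℝ}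
    (hG : ∀ n, StronglyMeasurable[ℱ n] (G n)) {C : ℝ} (hC : ∀ n ω, ‖G n ω‖ ≤ C) :
    IsL2MartingaleDiff μ ℱ (fun n ω => γ n * G n ω (Z n ω)) ∧
      ∀ n, ∫ ω, (γ n * G n ω (Z n ω)) ^ 2 ∂μ ≤ γ n ^ 2 * (C ^ 2 * s) := by
  have hm : ∀ n, StronglyMeasurable[ℱ (n + 1)] fun ω => G n ω (Z n ω) := fun n =>
    isBoundedBilinearMap_apply.continuous.comp_stronglyMeasurable
      (((hG n).mono (ℱ.mono n.le_succ)).prodMk (hZ.stronglyMeasurable n))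
  have hb : ∀ n ω, (γ n * G n ω (Z n ω)) ^ 2 ≤ γ n ^ 2 * (C ^ 2 * ‖Z n ω‖ ^ 2) := by
    intro n ω
    have h1 : |G n ω (Z n ω)| ≤ C * ‖Z n ω‖ :=
      ((G n ω).le_opNorm (Z n ω)).trans (by gcongr; exact hC n ω)
    rw [mul_pow, ← mul_pow C, ← sq_abs (G n ω (Z n ω))]
    gcongr
  have hL2 : ∀ n, MemLp (fun ω => γ n * G n ω (Z n ω)) 2 μ := by
    intro n
    have hm' : AEStronglyMeasurable (fun ω => γ n * G n ω (Z n ω)) μ :=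
      (((hm n).mono (ℱ.le _)).const_mul _).aestronglyMeasurable
    rw [memLp_two_iff_integrable_sq hm']
    refine (((hZ.integrable_sq n).const_mul (C ^ 2)).const_mul (γ n ^ 2)).mono' (hm'.pow 2)
      (ae_of_all _ fun ω => ?_)
    rw [Real.norm_of_nonneg (sq_nonneg _)]
    exact hb n ω
  refine ⟨⟨fun n => (hm n).const_mul _, hL2, fun n => ?_⟩, fun n => ?_⟩
  · have hi := (hL2 n).integrable one_le_two
    have h1 := condExp_bilin_of_stronglyMeasurable_left
      (B := γ n • ContinuousLinearMap.id ℝ (E →L[ℝ] ℝ)) (hG n) hi (hZ.integrable n)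
    refine EventuallyEq.trans h1 ?_
    filter_upwards [hZ.condExp n] with ω hω
    simp [hω]
  · calc ∫ ω, (γ n * G n ω (Z n ω)) ^ 2 ∂μ ≤ ∫ ω, γ n ^ 2 * (C ^ 2 * ‖Z n ω‖ ^ 2) ∂μ :=
          integral_mono (hL2 n).integrable_sq
            (((hZ.integrable_sq n).const_mul (C ^ 2)).const_mul (γ n ^ 2)) (hb n)
      _ ≤ γ n ^ 2 * (C ^ 2 * s) := by
          rw [integral_const_mul, integral_const_mul]
          gcongr
          exact hZ.integral_sq_le n

/-- The step-weighted noise series converges almost surely. -/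
theorem ae_cauchySeq_sum [FiniteDimensional ℝ E] (hZ : IsBoundedNoise μ ℱ s Z) {γ : ℕ → ℝ}
    (hγ : Summable fun n => γ n ^ 2) :
    ∀ᵐ ω ∂μ, CauchySeq fun n => ∑ k ∈ Finset.range n, γ k • Z k ω := by
  -- Coordinates reduce the claim to scalar martingales given by constant functionals.
  set b := Module.finBasis ℝ E
  have h1 : ∀ i, ∀ᵐ ω ∂μ, ∃ c, Tendsto
      (fun n => ∑ k ∈ Finset.range n, γ k * (b.coord i).toContinuousLinearMap (Z k ω)) atTop
      (𝓝 c) := by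
    intro i
    have h2 := hZ.isL2MartingaleDiff γ (G := fun _ _ => (b.coord i).toContinuousLinearMap)
      (fun _ => stronglyMeasurable_const) fun _ _ => le_rfl
    exact h2.1.ae_exists_tendsto_sum (hγ.mul_right _) h2.2
  filter_upwards [ae_all_iff.2 h1] with ω hω
  choose c hc using hω
  have h3 : Tendsto (fun n => ∑ i, (∑ k ∈ Finset.range n,
      γ k * (b.coord i).toContinuousLinearMap (Z k ω)) • b i) atTop (𝓝 (∑ i, c i • b i)) :=
    tendsto_finsetSum _ fun i _ => (hc i).smul_const _
  refine (h3.congr fun n => ?_).cauchySeq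
  rw [← b.sum_repr (∑ k ∈ Finset.range n, γ k • Z k ω)]
  refine Finset.sum_congr rfl fun i _ => ?_
  congr 1
  simp

-- The terms are nonnegative, so the infinite sum dominates all partial sums and a single Markov
-- inequality suffices.
omit [IsProbabilityMeasure μ] [CompleteSpace E] in
theorem measure_exists_le_sum_sq_le (hZ : IsBoundedNoise μ ℱ s Z) {γ : ℕ → ℝ}
    (hγ : Summable fun n => γ n ^ 2) {a : ℝ} (ha : 0 < a) :
    μ {ω | ∃ n, a ≤ ∑ k ∈ Finset.range n, γ k ^ 2 * ‖Z k ω‖ ^ 2} ≤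
      ENNReal.ofReal ((∑' k, γ k ^ 2) * s / a) := by
  have hs := hZ.nonneg
  have hm : ∀ k, AEMeasurable (fun ω => ENNReal.ofReal (γ k ^ 2 * ‖Z k ω‖ ^ 2)) μ := fun k =>
    ((hZ.integrable_sq k).aemeasurable.const_mul _).ennreal_ofReal
  have h1 : {ω | ∃ n, a ≤ ∑ k ∈ Finset.range n, γ k ^ 2 * ‖Z k ω‖ ^ 2} ⊆
      {ω | ENNReal.ofReal a ≤ ∑' k, ENNReal.ofReal (γ k ^ 2 * ‖Z k ω‖ ^ 2)} := by
    rintro ω ⟨n, hn⟩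
    refine (ENNReal.ofReal_le_ofReal hn).trans ?_
    rw [ENNReal.ofReal_sum_of_nonneg fun k _ => by positivity]
    exact ENNReal.sum_le_tsum _
  refine (measure_mono h1).trans ((meas_ge_le_lintegral_div (AEMeasurable.tsum hm)
    (by simpa using ha) ENNReal.ofReal_ne_top).trans ?_)
  rw [ENNReal.ofReal_div_of_pos ha, lintegral_tsum hm, ← tsum_mul_right,
    ENNReal.ofReal_tsum_of_nonneg (fun k => by positivity) (hγ.mul_right _)]
  refine ENNReal.div_le_div_right (ENNReal.tsum_le_tsum fun k => ?_) _
  rw [← ofReal_integral_eq_lintegral_ofReal ((hZ.integrable_sq k).const_mul _)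
    (ae_of_all _ fun ω => by positivity), integral_const_mul]
  refine ENNReal.ofReal_le_ofReal ?_
  gcongr
  exact hZ.integral_sq_le k

end IsBoundedNoise

end VectorNoise

/-- Step sizes that are `(1 + q)`-summable with `q < 1` vanish and are square-summable. -/
theorem summable_sq_of_summable_rpow {γ : ℕ → ℝ} (hγ : ∀ n, 0 < γ n) {q : ℝ}
    (hq : q ∈ Set.Ioo (0 : ℝ) 1) (hs : Summable fun n => γ n ^ (1 + q)) :
    Tendsto γ atTop (𝓝 0) ∧ Summable fun n => γ n ^ 2 := by
  have hq0 : 0 < 1 + q := by linarith [hq.1]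
  have h0 : Tendsto γ atTop (𝓝 0) := by
    have h1 := hs.tendsto_atTop_zero.rpow_const (p := (1 + q)⁻¹) (Or.inr (by positivity))
    rw [Real.zero_rpow (by positivity)] at h1
    refine h1.congr fun n => ?_
    rw [← Real.rpow_mul (hγ n).le, mul_inv_cancel₀ hq0.ne', Real.rpow_one]
  refine ⟨h0, hs.of_norm_bounded_eventually_nat ?_⟩
  filter_upwards [h0.eventually (gt_mem_nhds one_pos)] with n hn
  rw [Real.norm_of_nonneg (sq_nonneg _), ← Real.rpow_natCast]
  exact Real.rpow_le_rpow_of_exponent_ge (hγ n) hn.le (by push_cast; linarith [hq.2])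

/-! ### Matrix exponential learning: measurability, energy inequality, trapping -/

section Learning

variable {ι : Type*} [Fintype ι] [DecidableEq ι] {d : ι → ℕ} {A : ι → ℝ} {u : ι → Profile d → ℝ}

omit [Fintype ι] in
theorem isHermitian_payoffGradient (A : ι → ℝ) (u : ι → Profile d → ℝ) (X : Profile d) (i : ι) :
    (payoffGradient A u X i).IsHermitian := by
  rw [payoffGradient]
  split_ifs with h
  exacts [h.choose_spec.1, Matrix.isHermitian_zero]

omit [Fintype ι] [DecidableEq ι] in
theorem isHermitian_real_smul {M : Profile d} (hM : ∀ i, (M i).IsHermitian) (c : ℝ) (i : ι) :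
    ((c • M) i).IsHermitian := by
  rw [Pi.smul_apply, Matrix.IsHermitian, Matrix.conjTranspose_smul, (hM i).eq, star_trivial]

theorem exists_norm_payoffGradient_le (hu : IsConcaveGame A u) :
    ∃ B, 0 ≤ B ∧ ∀ X ∈ feasible A, ‖payoffGradient A u X‖ ≤ B := by
  obtain ⟨B, hB⟩ := (isCompact_feasible A).exists_bound_of_continuousOn hu.continuous_gradient
  exact ⟨max B 0, le_max_right _ _, fun X hX => (hB X hX).trans (le_max_left _ _)⟩

omit [DecidableEq ι] in
theorem exists_norm_sub_le (A : ι → ℝ) (P : Profile d) :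
    ∃ R, 0 ≤ R ∧ ∀ X ∈ feasible A, ‖X - P‖ ≤ R := by
  obtain ⟨R, hR⟩ := (isCompact_feasible A).exists_bound_of_continuousOn
    (f := fun X : Profile d => X - P) (by fun_prop)
  exact ⟨max R 0, le_max_right _ _, fun X hX => (hR X hX).trans (le_max_left _ _)⟩

theorem continuousOn_tracePairing_payoffGradient (hu : IsConcaveGame A u) (P : Profile d) :
    ContinuousOn (fun X => tracePairing (X - P) (payoffGradient A u X)) (feasible A) := by
  have h1 : ContinuousOn (fun X => tracePairingCLM d (X - P)) (feasible A) := by fun_prop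
  exact h1.clm_apply hu.continuous_gradient

omit [DecidableEq ι] in
theorem continuousOn_mirrorMap (hA : ∀ i, 0 < A i) :
    ContinuousOn (mirrorMap A) {Y : Profile d | ∀ i, (Y i).IsHermitian} := by
  refine LipschitzOnWith.continuousOn (K := (mirrorLipschitz d A).toNNReal)
    (LipschitzOnWith.of_dist_le_mul fun Y hY Y' hY' => ?_)
  rw [dist_eq_norm, dist_eq_norm, Real.coe_toNNReal _ (mirrorLipschitz_nonneg hA)]
  exact norm_mirrorMap_sub_le hA hY' hY

variable {Ω : Type*} [MeasurableSpace Ω] {γ : ℕ → ℝ} {Y Z : ℕ → Ω → Profile d}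

namespace IsMXL

omit [Fintype ι] in
theorem isHermitian_score (h : IsMXL A u γ Y Z) (n : ℕ) (ω : Ω) (i : ι) :
    (Y n ω i).IsHermitian := by
  induction n generalizing i with
  | zero => exact h.hermitian_init ω i
  | succ n ih =>
    rw [h.step]
    exact (ih i).add (isHermitian_real_smul (fun i =>
      (isHermitian_payoffGradient A u _ i).add (h.hermitian_noise n ω i)) _ i)

omit [Fintype ι] in
theorem play_mem_interiorProfiles (hA : ∀ i, 0 < A i) (h : IsMXL A u γ Y Z) (n : ℕ) (ω : Ω) :
    play A Y n ω ∈ interiorProfiles A :=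
  mirrorMap_mem_interiorProfiles hA (h.isHermitian_score n ω)

omit [Fintype ι] in
theorem play_mem_feasible (hA : ∀ i, 0 < A i) (h : IsMXL A u γ Y Z) (n : ℕ) (ω : Ω) :
    play A Y n ω ∈ feasible A :=
  interiorProfiles_subset_feasible (h.play_mem_interiorProfiles hA n ω)

theorem stronglyMeasurable_play (hA : ∀ i, 0 < A i) (h : IsMXL A u γ Y Z) (n : ℕ) :
    StronglyMeasurable (play A Y n) :=
  (h.measurable_score n).comp_continuousOn (continuousOn_mirrorMap hA) (h.isHermitian_score n)

/-- The filtration generated by the history of play. -/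
noncomputable def historyFiltration (hA : ∀ i, 0 < A i) (h : IsMXL A u γ Y Z) :
    Filtration ℕ (inferInstance : MeasurableSpace Ω) where
  seq := playHistory (play A Y)
  mono' _ _ hnm := iSup_mono fun _ => iSup_mono' fun hk => ⟨hk.trans hnm, le_rfl⟩
  le' n := by
    borelize (Profile d)
    exact iSup₂_le fun k _ => (h.stronglyMeasurable_play hA k).measurable.comap_le

theorem stronglyMeasurable_play_history (hA : ∀ i, 0 < A i) (h : IsMXL A u γ Y Z) {k n : ℕ}
    (hkn : k ≤ n) : StronglyMeasurable[h.historyFiltration hA n] (play A Y k) := by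
  borelize (Profile d)
  have h1 : Measurable[h.historyFiltration hA n] (play A Y k) :=
    (comap_measurable (play A Y k)).mono (le_iSup₂_of_le k hkn le_rfl) le_rfl
  exact h1.stronglyMeasurable

/-- Scores are a continuous function of interior plays, so the history of play already determines
them. -/
theorem stronglyMeasurable_score_history (hA : ∀ i, 0 < A i) (h : IsMXL A u γ Y Z) {k n : ℕ}
    (hkn : k ≤ n) : StronglyMeasurable[h.historyFiltration hA n] (Y k) := by
  have h1 := (h.stronglyMeasurable_play_history hA hkn).comp_continuousOn
    continuousOn_scoreOf (h.play_mem_interiorProfiles hA k)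
  convert h1 using 2 with ω
  exact (scoreOf_mirrorMap hA (h.isHermitian_score k ω)).symm

/-- The noise is a rescaled score increment minus `V(X(n))`; it is thus revealed one round later, as
the martingale structure requires. -/
theorem stronglyMeasurable_noise_history (hu : IsConcaveGame A u) (h : IsMXL A u γ Y Z)
    (hγ : ∀ n, 0 < γ n) (n : ℕ) :
    StronglyMeasurable[h.historyFiltration hu.radius_pos (n + 1)] (Z n) := by
  have hA := hu.radius_pos
  have h1 := h.stronglyMeasurable_score_history hA (le_refl (n + 1))
  have h2 := h.stronglyMeasurable_score_history hA n.le_succ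
  have h3 := (h.stronglyMeasurable_play_history hA n.le_succ).comp_continuousOn
    hu.continuous_gradient (h.play_mem_feasible hA n)
  have h4 : Z n = fun ω => (γ n)⁻¹ • (Y (n + 1) ω - Y n ω) -
      payoffGradient A u (play A Y n ω) := by
    ext1 ω
    rw [h.step n ω, add_sub_cancel_left, inv_smul_smul₀ (hγ n).ne', add_sub_cancel_left]
  rw [h4]
  exact ((h1.sub h2).const_smul (γ n)⁻¹).sub h3

/-- Conditionally on an initial event, the errors remain bounded noise. -/
theorem isBoundedNoise_cond (hu : IsConcaveGame A u) (h : IsMXL A u γ Y Z) (hγ : ∀ n, 0 < γ n)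
    {μ : Measure Ω} [IsProbabilityMeasure μ] (h1 : ZeroMeanNoise μ (play A Y) Z) {σ : ℝ}
    (h2 : SubexpNoise μ σ (play A Y) Z) {U : Set (Profile d)}
    (hU : MeasurableSet[borel (Profile d)] U) (hU0 : μ {ω | play A Y 0 ω ∈ U} ≠ 0) :
    IsBoundedNoise (μ[|{ω | play A Y 0 ω ∈ U}]) (h.historyFiltration hu.radius_pos) (σ ^ 2) Z := by
  have hA := hu.radius_pos
  -- The event depends on `X(0)` only, so it lies in every `σ`-algebra of the filtration and
  -- conditioning on it keeps the noise centred.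
  have hS : ∀ n, MeasurableSet[h.historyFiltration hA n] {ω | play A Y 0 ω ∈ U} := fun n => by
    borelize (Profile d)
    exact (h.stronglyMeasurable_play_history hA n.zero_le).measurable hU
  have hc : (μ {ω | play A Y 0 ω ∈ U})⁻¹ ≠ ⊤ := ENNReal.inv_ne_top.2 hU0
  refine ⟨h.stronglyMeasurable_noise_history hu hγ, fun n => (h1 n).1.restrict.smul_measure hc,
    fun n => ?_, fun n => (h2 n 2 one_le_two).1.restrict.smul_measure hc, fun n => ?_⟩
  · exact condExp_cond_eq_zero ((h.historyFiltration hA).le n) (h1 n).1 (h1 n).2 (hS n)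
  · refine integral_cond_le ((h.historyFiltration hA).le n) (h2 n 2 one_le_two).1 ?_ (hS n) hU0
    filter_upwards [(h2 n 2 one_le_two).2] with ω hω
    refine hω.trans_eq ?_
    norm_num [Nat.factorial]

omit [Fintype ι] in
theorem sum_step (h : IsMXL A u γ Y Z) (ω : Ω) {n m : ℕ} (hnm : n ≤ m) :
    Y m ω - Y n ω = ∑ k ∈ Finset.Ico n m, γ k • payoffGradient A u (play A Y k ω) +
      (∑ k ∈ Finset.range m, γ k • Z k ω - ∑ k ∈ Finset.range n, γ k • Z k ω) := by
  induction m, hnm using Nat.le_induction with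
  | base => simp
  | succ m hm ih =>
    rw [Finset.sum_Ico_succ_top hm, Finset.sum_range_succ, h.step, add_sub_right_comm, ih, smul_add]
    abel

/-- Displacement of the play between two rounds. -/
theorem norm_play_sub_le (hA : ∀ i, 0 < A i) (h : IsMXL A u γ Y Z) (hγ : ∀ n, 0 < γ n) {B : ℝ}
    (hB : ∀ X ∈ feasible A, ‖payoffGradient A u X‖ ≤ B) (ω : Ω) {n m : ℕ} (hnm : n ≤ m) :
    ‖play A Y m ω - play A Y n ω‖ ≤ mirrorLipschitz d A * (B * ∑ k ∈ Finset.Ico n m, γ k +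
      ‖∑ k ∈ Finset.range m, γ k • Z k ω - ∑ k ∈ Finset.range n, γ k • Z k ω‖) := by
  refine (norm_mirrorMap_sub_le hA (h.isHermitian_score n ω) (h.isHermitian_score m ω)).trans
    (mul_le_mul_of_nonneg_left ?_ (mirrorLipschitz_nonneg hA))
  rw [h.sum_step ω hnm, Finset.mul_sum]
  refine (norm_add_le _ _).trans (add_le_add_left (norm_sum_le_of_le _ fun k _ => ?_) _)
  rw [norm_smul, Real.norm_of_nonneg (hγ k).le, mul_comm]
  exact mul_le_mul_of_nonneg_right (hB _ (h.play_mem_feasible hA k ω)) (hγ k).le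

/-- One-step growth of the divergence along the play. -/
theorem klDivergence_play_succ_le (hA : ∀ i, 0 < A i) (h : IsMXL A u γ Y Z) {B : ℝ}
    (hB : ∀ X ∈ feasible A, ‖payoffGradient A u X‖ ≤ B) (P : Profile d) (n : ℕ) (ω : Ω) :
    klDivergence A P (play A Y (n + 1) ω) ≤ klDivergence A P (play A Y n ω) +
      γ n * tracePairing (play A Y n ω - P) (payoffGradient A u (play A Y n ω)) +
      γ n * tracePairing (play A Y n ω - P) (Z n ω) +
      2 * (‖tracePairingCLM d‖ * mirrorLipschitz d A) *
        (γ n ^ 2 * B ^ 2 + γ n ^ 2 * ‖Z n ω‖ ^ 2) := by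
  have hH := h.isHermitian_score n ω
  have h1 := klDivergence_mirrorMap_add_le hA (P := P) hH (W := γ n • (payoffGradient A u
    (play A Y n ω) + Z n ω)) (isHermitian_real_smul (fun i =>
      (isHermitian_payoffGradient A u _ i).add (h.hermitian_noise n ω i)) _)
  rw [← h.step n ω] at h1
  have h2 : tracePairing (mirrorMap A (Y n ω) - P) (γ n • (payoffGradient A u
      (play A Y n ω) + Z n ω)) =
      γ n * tracePairing (play A Y n ω - P) (payoffGradient A u (play A Y n ω)) +
      γ n * tracePairing (play A Y n ω - P) (Z n ω) := by
    rw [← tracePairingCLM_apply, map_smul, map_add, smul_eq_mul, mul_add]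
    rfl
  have h3 : ‖γ n • (payoffGradient A u (play A Y n ω) + Z n ω)‖ ^ 2 ≤
      2 * (γ n ^ 2 * B ^ 2 + γ n ^ 2 * ‖Z n ω‖ ^ 2) := by
    rw [norm_smul, mul_pow, Real.norm_eq_abs, sq_abs]
    have h4 : ‖payoffGradient A u (play A Y n ω) + Z n ω‖ ≤ B + ‖Z n ω‖ :=
      (norm_add_le _ _).trans (add_le_add_left (hB _ (h.play_mem_feasible hA n ω)) _)
    have h5 : ‖payoffGradient A u (play A Y n ω) + Z n ω‖ ^ 2 ≤ 2 * (B ^ 2 + ‖Z n ω‖ ^ 2) :=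
      (pow_le_pow_left₀ (norm_nonneg _) h4 2).trans (by nlinarith [sq_nonneg (B - ‖Z n ω‖)])
    nlinarith [mul_le_mul_of_nonneg_left h5 (sq_nonneg (γ n))]
  have h6 := mul_le_mul_of_nonneg_left h3
    (mul_nonneg (norm_nonneg (tracePairingCLM d)) (mirrorLipschitz_nonneg (d := d) hA))
  rw [h2] at h1
  change klDivergence A P (mirrorMap A (Y (n + 1) ω)) ≤ klDivergence A P (mirrorMap A (Y n ω)) +
    _ + _ + _
  linarith

end IsMXL

/-- A perturbed descent recursion stays in the region where its drift is nonpositive, and the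
accumulated drift is bounded. -/
theorem descent_trap {D w ξ e : ℕ → ℝ} {m : ℝ} (hD : ∀ n, 0 ≤ D n)
    (hrec : ∀ n, D (n + 1) ≤ D n + w n + ξ n + e n) (hD0 : D 0 < m)
    (hw : ∀ n, D n < 3 * m → w n ≤ 0) (hξ : ∀ n, ∑ k ∈ Finset.range n, ξ k < m)
    (he : ∀ n, ∑ k ∈ Finset.range n, e k ≤ m) :
    (∀ n, D n < 3 * m) ∧ Summable w := by
  have h1 : ∀ n, D n ≤ D 0 + ∑ k ∈ Finset.range n, w k + ∑ k ∈ Finset.range n, ξ k +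
      ∑ k ∈ Finset.range n, e k := by
    intro n
    induction n with
    | zero => simp
    | succ n ih =>
      simp only [Finset.sum_range_succ]
      linarith [hrec n]
  -- While the past stays in the region its drift is nonpositive, so the initial value, the noise
  -- and the errors contribute at most `m` each.
  have h2 : ∀ n, D n < 3 * m := by
    intro n
    induction n using Nat.strong_induction_on with
    | _ n ih =>
      have h3 : ∑ k ∈ Finset.range n, w k ≤ 0 :=
        Finset.sum_nonpos fun k hk => hw k (ih k (Finset.mem_range.1 hk))
      linarith [h1 n, hξ n, he n]
  refine ⟨h2, ?_⟩
  rw [← summable_neg_iff]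
  refine summable_of_sum_range_le (c := 3 * m) (fun n => neg_nonneg.2 (hw n (h2 n))) fun n => ?_
  rw [Finset.sum_neg_distrib]
  linarith [h1 n, hξ n, he n, hD n]

end Learning

/-! ### Convergence on the good event and the main theorem -/

section Convergence

variable {ι : Type*} [Fintype ι] [DecidableEq ι] {d : ι → ℕ} {A : ι → ℝ} {u : ι → Profile d → ℝ}

/-- Halving the radius gives a closed ball, whose intersection with the feasible set is compact. -/
theorem IsVariationallyStable.exists_radius {Xs : Profile d} (h : IsVariationallyStable A u Xs) :
    ∃ r > 0, ∀ X ∈ feasible A, ‖X - Xs‖ ≤ r → X ≠ Xs →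
      tracePairing (X - Xs) (payoffGradient A u X) < 0 := by
  obtain ⟨r, hr, hball⟩ := Metric.mem_nhdsWithin_iff.1 h.2
  refine ⟨r / 2, half_pos hr, fun X hX hXr => hball ⟨?_, hX⟩⟩
  rw [Metric.mem_ball, dist_eq_norm]
  linarith

/-- Almost every trajectory which starts in the divergence ball and whose noise stays small
converges to the stable point. -/
theorem IsMXL.tendsto_play {Ω : Type*} [MeasurableSpace Ω] {γ : ℕ → ℝ} {Y Z : ℕ → Ω → Profile d}
    (hu : IsConcaveGame A u) (h : IsMXL A u γ Y Z) (hγ : ∀ n, 0 < γ n) {Xs : Profile d}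
    (hXs : Xs ∈ feasible A) {r : ℝ} (hr : 0 < r)
    (hstable : ∀ X ∈ feasible A, ‖X - Xs‖ ≤ r → X ≠ Xs →
      tracePairing (X - Xs) (payoffGradient A u X) < 0) {B : ℝ} (hB0 : 0 ≤ B)
    (hB : ∀ X ∈ feasible A, ‖payoffGradient A u X‖ ≤ B) {m : ℝ}
    (hm : 4 * (∑ i, A i) * (3 * m) ≤ r ^ 2) {a : ℝ}
    (hγ0 : Tendsto γ atTop (𝓝 0)) (hγs : ¬ Summable γ) (hγ2 : Summable fun n => γ n ^ 2)
    (hδ : 2 * (‖tracePairingCLM d‖ * mirrorLipschitz d A) * ((∑' n, γ n ^ 2) * B ^ 2 + a) ≤ m)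
    {ω : Ω} (hinit : klDivergence A Xs (play A Y 0 ω) < m)
    (hξ : ∀ n, ∑ k ∈ Finset.range n, γ k * tracePairing (play A Y k ω - Xs) (Z k ω) < m)
    (hZ : ∀ n, ∑ k ∈ Finset.range n, γ k ^ 2 * ‖Z k ω‖ ^ 2 ≤ a)
    (hW : CauchySeq fun n => ∑ k ∈ Finset.range n, γ k • Z k ω) :
    Tendsto (fun n => play A Y n ω) atTop (𝓝 Xs) := by
  have hA := hu.radius_pos
  have hle : ∀ X ∈ feasible A, ‖X - Xs‖ ≤ r →
      tracePairing (X - Xs) (payoffGradient A u X) ≤ 0 := by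
    intro X hX hXr
    rcases eq_or_ne X Xs with rfl | hne
    · simp [tracePairing]
    · exact (hstable X hX hXr hne).le
  have hclose : ∀ n, klDivergence A Xs (play A Y n ω) < 3 * m → ‖play A Y n ω - Xs‖ ≤ r := by
    intro n hn
    have h1 := sq_norm_sub_le_klDivergence hA hXs (h.play_mem_interiorProfiles hA n ω)
    rw [norm_sub_rev] at h1
    have hS : 0 ≤ ∑ i, A i := Finset.sum_nonneg fun i _ => (hA i).le
    refine (pow_le_pow_iff_left₀ (norm_nonneg _) hr.le two_ne_zero).1 (h1.trans (le_trans ?_ hm))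
    gcongr
  have hC : 0 ≤ 2 * (‖tracePairingCLM d‖ * mirrorLipschitz d A) :=
    mul_nonneg two_pos.le (mul_nonneg (norm_nonneg (tracePairingCLM d)) (mirrorLipschitz_nonneg hA))
  obtain ⟨htrap, hsum⟩ := descent_trap (m := m)
    (D := fun n => klDivergence A Xs (play A Y n ω))
    (w := fun n => γ n * tracePairing (play A Y n ω - Xs) (payoffGradient A u (play A Y n ω)))
    (ξ := fun n => γ n * tracePairing (play A Y n ω - Xs) (Z n ω))
    (e := fun n => 2 * (‖tracePairingCLM d‖ * mirrorLipschitz d A) *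
        (γ n ^ 2 * B ^ 2 + γ n ^ 2 * ‖Z n ω‖ ^ 2))
    (fun n => klDivergence_mirrorMap_nonneg hA hXs (h.isHermitian_score n ω))
    (fun n => h.klDivergence_play_succ_le hA hB Xs n ω) hinit
    (fun n hn => mul_nonpos_of_nonneg_of_nonpos (hγ n).le
      (hle _ (h.play_mem_feasible hA n ω) (hclose n hn))) hξ
    (fun n => by
      rw [← Finset.mul_sum, Finset.sum_add_distrib, ← Finset.sum_mul]
      refine (mul_le_mul_of_nonneg_left (add_le_add ?_ (hZ n)) hC).trans hδ
      exact mul_le_mul_of_nonneg_right (hγ2.sum_le_tsum _ fun k _ => sq_nonneg _) (sq_nonneg B))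
  exact tendsto_of_summable_step_mul (K := feasible A ∩ {X | ‖X - Xs‖ ≤ r})
    ((isCompact_feasible A).inter_right (isClosed_le (by fun_prop) continuous_const))
    ((continuousOn_tracePairing_payoffGradient hu Xs).mono Set.inter_subset_left)
    (fun X hX => hstable X hX.1 hX.2) (fun X hX => hle X hX.1 hX.2)
    (fun n => ⟨h.play_mem_feasible hA n ω, hclose n (htrap n)⟩) hγ hγ0 hγs hsum hW
    (mirrorLipschitz_nonneg hA) hB0 fun n m hnm => h.norm_play_sub_le hA hγ hB ω hnm

end Convergence

theorem mainTheorem3 {ι : Type*} [Fintype ι] [DecidableEq ι] (d : ι → ℕ) (A : ι → ℝ)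
    (u : ι → Profile d → ℝ) (hu : IsConcaveGame A u)
    (Xs : Profile d) (hXs : IsVariationallyStable A u Xs) :
    ∀ ε > (0 : ℝ), ∃ U : Set (Profile d),
      U ⊆ feasible A ∧ MeasurableSet[borel (Profile d)] U ∧
      IsDivergenceNhd A Xs U ∧
      ((∀ i, Xs i = 0 ∨ (Xs i).PosDef) → U ∈ 𝓝[feasible A] Xs) ∧
      ∀ σ > (0 : ℝ), ∃ δ > (0 : ℝ), ∀ γ : ℕ → ℝ, (∀ n, 0 < γ n) →
        (∃ q ∈ Set.Ioo (0 : ℝ) 1, Summable fun n => γ n ^ (1 + q)) → ¬ Summable γ →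
        ∑' n, γ n ^ 2 ≤ δ →
        ∀ (Ω : Type*) [MeasurableSpace Ω] (μ : Measure Ω) [IsProbabilityMeasure μ]
          (Y Z : ℕ → Ω → Profile d),
          IsMXL A u γ Y Z → ZeroMeanNoise μ (play A Y) Z → SubexpNoise μ σ (play A Y) Z →
          μ {ω | play A Y 0 ω ∈ U} ≠ 0 →
          1 - ε ≤ (μ[|{ω | play A Y 0 ω ∈ U}]).real
            {ω | Tendsto (fun n => play A Y n ω) atTop (𝓝 Xs)} := by
  intro ε hε
  have hA := hu.radius_pos
  obtain ⟨r, hr, hstable⟩ := hXs.exists_radius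
  obtain ⟨B, hB0, hB⟩ := exists_norm_payoffGradient_le hu
  obtain ⟨R, hR0, hR⟩ := exists_norm_sub_le A Xs
  have hS : 0 ≤ ∑ i, A i := Finset.sum_nonneg fun i _ => (hA i).le
  obtain ⟨m, hm0, hm⟩ : ∃ m > 0, 4 * (∑ i, A i) * (3 * m) ≤ r ^ 2 := by
    -- The `+ 1` keeps the denominator positive when there are no players.
    refine ⟨r ^ 2 / (12 * (∑ i, A i + 1)), by positivity, ?_⟩
    have : 4 * (∑ i, A i) * (3 * (r ^ 2 / (12 * (∑ i, A i + 1)))) =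
        r ^ 2 * ((∑ i, A i) / (∑ i, A i + 1)) := by
      field_simp
      ring
    rw [this]
    refine mul_le_of_le_one_right (sq_nonneg r) ?_
    rw [div_le_one (by positivity)]
    linarith
  -- The neighbourhood comes from the stability radius alone; `ε` and `σ` enter only through `δ`.
  refine ⟨divergenceBall A Xs m, fun X hX => hX.1, measurableSet_divergenceBall Xs m,
    isDivergenceNhd_divergenceBall hXs.1 hm0,
    fun h => divergenceBall_mem_nhdsWithin h hm0, fun σ hσ => ?_⟩
  set C : ℝ := 2 * (‖tracePairingCLM d‖ * mirrorLipschitz d A) with hC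
  have hC0 : 0 ≤ C := mul_nonneg two_pos.le
    (mul_nonneg (norm_nonneg (tracePairingCLM d)) (mirrorLipschitz_nonneg hA))
  -- The gradient and noise parts of the quadratic error get a budget `a` each, and `C (a + a) ≤ m`.
  set a : ℝ := m / (2 * (C + 1)) with ha
  have ha0 : 0 < a := by positivity
  -- `Q ∑ γ²` is the sum of the Doob and Markov failure probabilities.
  set Q : ℝ := (‖tracePairingCLM d‖ * R) ^ 2 * σ ^ 2 / m ^ 2 + σ ^ 2 / a with hQ
  have hQ0 : 0 < Q := by positivity
  -- The first bound gives `B² ∑ γ² ≤ a`, the second a failure probability of at most `ε`.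
  refine ⟨min (a / (B ^ 2 + 1)) (ε / Q), by positivity, ?_⟩
  rintro γ hγ ⟨q, hq, hγq⟩ hγs hγδ Ω _ μ _ Y Z h hZ0 hZσ hU0
  obtain ⟨hγ0, hγ2⟩ := summable_sq_of_summable_rpow hγ hq hγq
  set S : Set Ω := {ω | play A Y 0 ω ∈ divergenceBall A Xs m} with hSdef
  have hSm : MeasurableSet S := by
    borelize (Profile d)
    exact (h.stronglyMeasurable_play hA 0).measurable (measurableSet_divergenceBall Xs m)
  have : IsProbabilityMeasure (μ[|S]) := cond_isProbabilityMeasure hU0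
  have hN := h.isBoundedNoise_cond hu hγ hZ0 hZσ (measurableSet_divergenceBall Xs m) hU0
  have hξ := hN.isL2MartingaleDiff γ (G := fun n ω => tracePairingCLM d (play A Y n ω - Xs))
    (fun n => (tracePairingCLM d).continuous.comp_stronglyMeasurable
      ((h.stronglyMeasurable_play_history hA le_rfl).sub stronglyMeasurable_const))
    (C := ‖tracePairingCLM d‖ * R) fun n ω => ((tracePairingCLM d).le_opNorm _).trans
      (mul_le_mul_of_nonneg_left (hR _ (h.play_mem_feasible hA n ω)) (norm_nonneg _))
  have hP1 := hξ.1.measure_exists_le_abs_sum_le (hγ2.mul_right _) hξ.2 hm0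
  have hP2 := hN.measure_exists_le_sum_sq_le hγ2 ha0
  have hδ : C * ((∑' n, γ n ^ 2) * B ^ 2 + a) ≤ m := by
    have h1 : (∑' n, γ n ^ 2) * (B ^ 2 + 1) ≤ a :=
      (le_div_iff₀ (by positivity)).1 (hγδ.trans (min_le_left _ _))
    have h2 : 0 ≤ ∑' n, γ n ^ 2 := tsum_nonneg fun n => sq_nonneg _
    have h3 : a * (2 * (C + 1)) = m := div_mul_cancel₀ _ (by positivity)
    calc C * ((∑' n, γ n ^ 2) * B ^ 2 + a) ≤ C * (a + a) := by
          gcongr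
          linarith
      _ ≤ m := by linarith
  set T : Set Ω := {ω | Tendsto (fun n => play A Y n ω) atTop (𝓝 Xs)} with hT
  set b1 : Set Ω := {ω | ∃ n, m ≤ |∑ k ∈ Finset.range n,
    γ k * tracePairingCLM d (play A Y k ω - Xs) (Z k ω)|} with hb1
  set b2 : Set Ω := {ω | ∃ n, a ≤ ∑ k ∈ Finset.range n, γ k ^ 2 * ‖Z k ω‖ ^ 2} with hb2
  have hgood : ∀ᵐ ω ∂(μ[|S]), ω ∈ Tᶜ → ω ∈ b1 ∪ b2 := by
    filter_upwards [hN.ae_cauchySeq_sum hγ2, ae_cond_mem hSm] with ω hω hωS hωT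
    by_contra hbad
    simp only [hb1, hb2, Set.mem_union, Set.mem_ofPred_eq, not_or, not_exists, not_le] at hbad
    exact hωT (h.tendsto_play hu hγ hXs.1 hr hstable hB0 hB hm hγ0 hγs hγ2 hδ
      (hωS.2 (h.play_mem_interiorProfiles hA 0 ω)) (fun n => (le_abs_self _).trans_lt (hbad.1 n))
      (fun n => (hbad.2 n).le) hω)
  have hTc : (μ[|S]) Tᶜ ≤ ENNReal.ofReal ε := by
    refine (measure_mono_ae hgood).trans ((measure_union_le _ _).trans
      ((add_le_add hP1 hP2).trans ?_))
    have h2 : 0 ≤ ∑' n, γ n ^ 2 := tsum_nonneg fun n => sq_nonneg _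
    rw [tsum_mul_right, ← ENNReal.ofReal_add (by positivity) (by positivity)]
    refine ENNReal.ofReal_le_ofReal ?_
    calc _ = (∑' n, γ n ^ 2) * Q := by
          rw [hQ]
          ring
      _ ≤ ε := (le_div_iff₀ hQ0).1 (hγδ.trans (min_le_right _ _))
  have h1 : (1 : ℝ) ≤ (μ[|S]).real T + (μ[|S]).real Tᶜ := by
    rw [← probReal_univ (μ := μ[|S]), ← Set.union_compl_self T]
    exact measureReal_union_le _ _
  have h2 : (μ[|S]).real Tᶜ ≤ ε := ENNReal.toReal_le_of_le_ofReal hε.le hTc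
  linarith
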